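/- Let $d\ge 1$, let $(\Omega,\mathcal F,\mu)$ be a probability space, let $\theta:\Omega\to\Omega$ be an invertible ergodic $\mu$-preserving transformation (with measurable inverse), and let $\omega\mapsto\phi_\omega$ be a measurable family of linear maps on $M_d(\mathbb C)$ that are almost surely quantum channels (completely positive and trace preserving). Let $\mathcal M$ be the algebra of random matrices, i.e. of measurable maps $\Omega\to M_d(\mathbb C)$ modulo almost everywhere equality, and define on $\mathcal M$ the operators $$\mathfrak L(a)_\omega=\phi_\omega(a_{\theta^{-1}(\omega)}),\qquad \mathfrak L^\dagger(a)_\omega=\phi^\dagger_{\theta(\omega)}(a_{\theta(\omega)}),$$ where $\phi_\omega^\dagger$ is the adjoint of $\phi_\omega$ with respect to $\langle a,b\rangle=\operatorname{Tr}(a^*b)$. These restrict to bounded operators $\mathfrak L_1$ on $L^1(\Omega;M_d(\mathbb C))$ and $\mathfrak L_1^\dagger$ on $L^\infty(\Omega;M_d(\mathbb C))$. Let $\Lambda_{\mathfrak L}$ (resp. $\Lambda^\dagger_{\mathfrak L}$) be the set of peripheral eigenvalues of $\mathfrak L_1$ (resp. $\mathfrak L_1^\dagger$), that is, of the eigenvalues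 whose modulus equals the spectral radius of the operator. Assume that $\mathfrak L$ is irreducible: whenever $p\in\mathcal M$ is almost surely a nonzero orthogonal projection such that $p\,\mathfrak L(a)\,p=\mathfrak L(a)$ for all $a\in\mathcal M$ with $pap=a$, then $p=\mathbb I$. Then: 1. $\Lambda_{\mathfrak L}$ is a group under multiplication, namely a subgroup of the unit circle $\{z\in\mathbb C: |z|=1\}$. 2. $\Lambda_{\mathfrak L}=\Lambda_{\mathfrak L}^\dagger$. Moreover $\Lambda_{\mathfrak L}$ is the set of $\alpha\in\mathbb C$ with $|\alpha|=1$ for which there is a nonzero $x\in\mathcal M$ with $\mathfrak L(x)=\alpha x$, and $\Lambda_{\mathfrak L}^\dagger$ is the set of $\alpha\in\mathbb C$ with $|\alpha|=1$ for which there is a nonzero $x\in\mathcal M$ with $\mathfrak L^\dagger(x)=\alpha x$. 3. If $|\alpha|=1$ and $x\in\mathcal M$ is nonzero with $\mathfrak L^\dagger(x)=\alpha x$, then $x=\lambda u$ for a nonzero constant $\lambda\in\mathbb C$ and some $u\in\mathcal M$ that is almost surely unitary. -/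

import Mathlib

open MeasureTheory
open scoped ENNReal NNReal Matrix Matrix.Norms.L2Operator MatrixOrder

noncomputable section

namespace QuantumProcess

/-- The `d × d` complex matrices, with their C⋆-norm (operator norm on Euclidean space) and the
positive semidefinite order. -/
abbrev Mat (d : ℕ) : Type := Matrix (Fin d) (Fin d) ℂ

section Channels

variable {d : ℕ}

/-- Quantum channels: completely positive and trace preserving linear maps on `Mat d`. -/
def IsQuantumChannel (φ : Mat d →ₗ[ℂ] Mat d) : Prop :=
  (∃ Φ : CompletelyPositiveMap (Mat d) (Mat d), Φ.toLinearMap = φ) ∧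
    ∀ a, (φ a).trace = a.trace

/-- The adjoint of a linear map on `Mat d` for the Hilbert–Schmidt inner product
`⟪a, b⟫ = Tr (aᴴ * b)`, written out in matrix units; see `hsAdjoint_spec` and
`hsAdjoint_unique`. -/
def hsAdjoint (ψ : Mat d →ₗ[ℂ] Mat d) : Mat d →ₗ[ℂ] Mat d where
  toFun b := Matrix.of fun i j => ((ψ (Matrix.single i j 1))ᴴ * b).trace
  map_add' b c := by ext i j; simp [mul_add]
  map_smul' r b := by ext i j; simp

theorem hsAdjoint_spec (ψ : Mat d →ₗ[ℂ] Mat d) (a b : Mat d) :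
    (aᴴ * hsAdjoint ψ b).trace = ((ψ a)ᴴ * b).trace := by
  have key : ∀ i j (z : ℂ), ((Matrix.single i j z)ᴴ * hsAdjoint ψ b).trace =
      ((ψ (Matrix.single i j z))ᴴ * b).trace := by
    intro i j z
    have h1 : (Matrix.single i j z : Mat d) = z • Matrix.single i j 1 := by
      simp [Matrix.smul_single]
    have h2 : ((Matrix.single i j (1 : ℂ))ᴴ * hsAdjoint ψ b).trace = hsAdjoint ψ b i j := by
      simp [Matrix.conjTranspose_single, Matrix.trace_single_mul]
    rw [h1, map_smul, Matrix.conjTranspose_smul, Matrix.conjTranspose_smul, Matrix.smul_mul,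
      Matrix.smul_mul, Matrix.trace_smul, Matrix.trace_smul, h2]
    rfl
  have ha : a = ∑ i, ∑ j, Matrix.single i j (a i j) := Matrix.matrix_eq_sum_single a
  conv_lhs => rw [ha]
  conv_rhs => rw [ha]
  simp only [map_sum, Matrix.conjTranspose_sum, Finset.sum_mul, Matrix.trace_sum, key]

theorem hsAdjoint_unique (ψ χ : Mat d →ₗ[ℂ] Mat d)
    (h : ∀ a b : Mat d, (aᴴ * χ b).trace = ((ψ a)ᴴ * b).trace) : χ = hsAdjoint ψ := by
  apply LinearMap.ext
  intro b
  ext i j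
  have := (h (Matrix.single i j 1) b).trans (hsAdjoint_spec ψ (Matrix.single i j 1) b).symm
  simpa [Matrix.conjTranspose_single, Matrix.trace_single_mul] using this

theorem norm_entry_le (a : Mat d) (i j : Fin d) : ‖a i j‖ ≤ ‖a‖ := by
  have h1 := Matrix.l2_opNorm_mulVec a (EuclideanSpace.single j (1 : ℂ))
  have h2 := PiLp.norm_apply_le
    ((EuclideanSpace.equiv (Fin d) ℂ).symm (a *ᵥ (EuclideanSpace.single j (1 : ℂ)).ofLp)) i
  have h3 := h2.trans h1
  simpa using h3

theorem norm_le_sum_entries (a : Mat d) : ‖a‖ ≤ ∑ i, ∑ j, ‖a i j‖ := by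
  have hu : ∀ i j : Fin d, ‖(Matrix.single i j (1 : ℂ) : Mat d)‖ ≤ 1 := by
    intro i j
    have h : ‖(Matrix.single i j (1 : ℂ) : Mat d)‖ * ‖(Matrix.single i j (1 : ℂ) : Mat d)‖
        ≤ 1 := by
      rw [← Matrix.l2_opNorm_conjTranspose_mul_self, Matrix.conjTranspose_single,
        Matrix.single_mul_single_same, ← Matrix.diagonal_single, Matrix.l2_opNorm_diagonal]
      refine (pi_norm_le_iff_of_nonneg zero_le_one).mpr fun k => ?_
      by_cases hk : k = j
      · subst hk; simp
      · simp [Pi.single_eq_of_ne hk]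
    nlinarith [norm_nonneg (Matrix.single i j (1 : ℂ) : Mat d)]
  have ha : a = ∑ i, ∑ j, a i j • Matrix.single i j 1 := by
    conv_lhs => rw [Matrix.matrix_eq_sum_single a]
    simp [Matrix.smul_single]
  conv_lhs => rw [ha]
  refine (norm_sum_le _ _).trans (Finset.sum_le_sum fun i _ => ?_)
  refine (norm_sum_le _ _).trans (Finset.sum_le_sum fun j _ => ?_)
  rw [norm_smul]
  exact mul_le_of_le_one_right (norm_nonneg _) (hu i j)

theorem norm_entry_le_trace {a : Mat d} (ha : 0 ≤ a) (i j : Fin d) :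
    ‖a i j‖ ≤ ‖a.trace‖ := by
  obtain ⟨b, rfl⟩ := CStarAlgebra.nonneg_iff_eq_star_mul_self.mp ha
  rw [Matrix.star_eq_conjTranspose]
  have htr : (bᴴ * b).trace = ((∑ i, ∑ k, ‖b k i‖ ^ 2 : ℝ) : ℂ) := by
    simp only [Matrix.trace, Matrix.diag, Matrix.mul_apply, Matrix.conjTranspose_apply]
    push_cast
    refine Finset.sum_congr rfl fun i _ => Finset.sum_congr rfl fun k _ => ?_
    exact RCLike.conj_mul (b k i)
  have hnn : ∀ i, 0 ≤ ∑ k, ‖b k i‖ ^ 2 := fun i => Finset.sum_nonneg fun k _ => by positivity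
  have hS : ∀ i, ∑ k, ‖b k i‖ ^ 2 ≤ ∑ i, ∑ k, ‖b k i‖ ^ 2 := fun i =>
    Finset.single_le_sum (f := fun i => ∑ k, ‖b k i‖ ^ 2) (fun i _ => hnn i) (Finset.mem_univ i)
  rw [htr, Complex.norm_real, Real.norm_of_nonneg (Finset.sum_nonneg fun i _ => hnn i),
    Matrix.mul_apply]
  have h1 : ‖∑ k, bᴴ i k * b k j‖ ≤ ∑ k, (‖b k i‖ ^ 2 / 2 + ‖b k j‖ ^ 2 / 2) := by
    refine (norm_sum_le _ _).trans (Finset.sum_le_sum fun k _ => ?_)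
    rw [norm_mul, Matrix.conjTranspose_apply, norm_star]
    nlinarith [sq_nonneg (‖b k i‖ - ‖b k j‖)]
  rw [Finset.sum_add_distrib, ← Finset.sum_div, ← Finset.sum_div] at h1
  linarith [hS i, hS j]

/-- A bound for quantum channels which depends on `d` only. -/
theorem IsQuantumChannel.norm_le {φ : Mat d →ₗ[ℂ] Mat d} (hφ : IsQuantumChannel φ) (a : Mat d) :
    ‖φ a‖ ≤ 4 * (d : ℝ) ^ 3 * ‖a‖ := by
  obtain ⟨⟨Φ, rfl⟩, htr⟩ := hφ
  have htrle : ∀ y : Mat d, ‖y.trace‖ ≤ d * ‖y‖ := fun y => by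
    refine (norm_sum_le _ _).trans ((Finset.sum_le_sum fun i _ => norm_entry_le y i i).trans ?_)
    simp
  have hpos : ∀ y : Mat d, 0 ≤ y → ‖Φ.toLinearMap y‖ ≤ (d : ℝ) ^ 3 * ‖y‖ := by
    intro y hy
    have h0 : 0 ≤ Φ.toLinearMap y := map_nonneg Φ hy
    calc ‖Φ.toLinearMap y‖ ≤ ∑ i, ∑ j, ‖(Φ.toLinearMap y) i j‖ := norm_le_sum_entries _
      _ ≤ ∑ _i : Fin d, ∑ _j : Fin d, (d : ℝ) * ‖y‖ := by
          refine Finset.sum_le_sum fun i _ => Finset.sum_le_sum fun j _ => ?_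
          refine (norm_entry_le_trace h0 i j).trans ?_
          rw [htr]
          exact htrle y
      _ = (d : ℝ) ^ 3 * ‖y‖ := by
          simp; ring
  obtain ⟨y, hy_nonneg, hy_norm, hy⟩ := CStarAlgebra.exists_sum_four_nonneg a
  conv_lhs => rw [hy]
  simp only [map_sum, map_smul]
  refine (norm_sum_le _ _).trans ?_
  have : ∀ i ∈ (Finset.univ : Finset (Fin 4)),
      ‖Complex.I ^ (i : ℕ) • Φ.toLinearMap (y i)‖ ≤ (d : ℝ) ^ 3 * ‖a‖ := by
    intro i _
    rw [norm_smul, norm_pow, Complex.norm_I, one_pow, one_mul]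
    refine (hpos _ (hy_nonneg i)).trans ?_
    gcongr
    exact hy_norm i
  refine (Finset.sum_le_sum this).trans ?_
  simp [mul_assoc]

theorem norm_hsAdjoint_le {ψ : Mat d →ₗ[ℂ] Mat d} {C : ℝ} (hψ : ∀ a, ‖ψ a‖ ≤ C * ‖a‖)
    (b : Mat d) :
    ‖hsAdjoint ψ b‖ ≤
      (∑ i : Fin d, ∑ j : Fin d, d * (C * ‖(Matrix.single i j 1 : Mat d)‖)) * ‖b‖ := by
  have htrle : ∀ y : Mat d, ‖y.trace‖ ≤ d * ‖y‖ := fun y => by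
    refine (norm_sum_le _ _).trans ((Finset.sum_le_sum fun i _ => norm_entry_le y i i).trans ?_)
    simp
  refine (norm_le_sum_entries _).trans ?_
  rw [Finset.sum_mul]
  refine Finset.sum_le_sum fun i _ => ?_
  rw [Finset.sum_mul]
  refine Finset.sum_le_sum fun j _ => ?_
  refine (htrle _).trans ?_
  rw [mul_assoc]
  refine mul_le_mul_of_nonneg_left ?_ (Nat.cast_nonneg d)
  refine (norm_mul_le _ _).trans ?_
  refine mul_le_mul_of_nonneg_right ?_ (norm_nonneg _)
  rw [Matrix.l2_opNorm_conjTranspose]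
  exact hψ _

end Channels

section Operators

variable {Ω : Type*} [MeasurableSpace Ω] {μ : Measure Ω} {d : ℕ}

/-- A random linear map `ψ : Ω → (Mat d →ₗ[ℂ] Mat d)` is measurable: all entries of its matrix in
a basis are measurable functions, equivalently all entries of `ψ ω a` are, for every `a`. -/
def MeasurableMap (ψ : Ω → (Mat d →ₗ[ℂ] Mat d)) : Prop :=
  ∀ (a : Mat d) (i j : Fin d), Measurable fun ω => ψ ω a i j

theorem MeasurableMap.hsAdjoint {ψ : Ω → (Mat d →ₗ[ℂ] Mat d)} (hψ : MeasurableMap ψ) :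
    MeasurableMap fun ω => hsAdjoint (ψ ω) := by
  intro b i j
  have : (fun ω => QuantumProcess.hsAdjoint (ψ ω) b i j) =
      fun ω => ∑ k, ∑ l, star (ψ ω (Matrix.single i j 1) l k) * b l k := by
    funext ω
    simp [QuantumProcess.hsAdjoint, Matrix.trace, Matrix.mul_apply]
  rw [this]
  refine Finset.measurable_sum _ fun k _ => Finset.measurable_sum _ fun l _ => ?_
  exact (Complex.continuous_conj.measurable.comp (hψ _ l k)).mul_const _

theorem MeasurableMap.comp {ψ : Ω → (Mat d →ₗ[ℂ] Mat d)} (hψ : MeasurableMap ψ) {T : Ω → Ω}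
    (hT : Measurable T) : MeasurableMap fun ω => ψ (T ω) :=
  fun a i j => (hψ a i j).comp hT

theorem MeasurableMap.aestronglyMeasurable_apply {ψ : Ω → (Mat d →ₗ[ℂ] Mat d)}
    (hψ : MeasurableMap ψ) {x : Ω → Mat d} (hx : AEStronglyMeasurable x μ) :
    AEStronglyMeasurable (fun ω => ψ ω (x ω)) μ := by
  have h1 : (fun ω => ψ ω (x ω)) =
      fun ω => ∑ i, ∑ j, x ω i j • ψ ω (Matrix.single i j 1) := by
    funext ω
    conv_lhs => rw [Matrix.matrix_eq_sum_single (x ω)]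
    simp only [map_sum]
    refine Finset.sum_congr rfl fun i _ => Finset.sum_congr rfl fun j _ => ?_
    rw [← map_smul, Matrix.smul_single, smul_eq_mul, mul_one]
  rw [h1]
  refine Finset.aestronglyMeasurable_fun_sum _ fun i _ =>
    Finset.aestronglyMeasurable_fun_sum _ fun j _ => ?_
  have hc : Continuous fun a : Mat d => a i j := (continuous_apply j).comp (continuous_apply i)
  refine (hc.comp_aestronglyMeasurable hx).smul ?_
  have h2 : (fun ω => ψ ω (Matrix.single i j 1)) =
      fun ω => ∑ k, ∑ l, ψ ω (Matrix.single i j 1) k l • (Matrix.single k l (1 : ℂ) : Mat d) := by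
    funext ω
    conv_lhs => rw [Matrix.matrix_eq_sum_single (ψ ω (Matrix.single i j 1))]
    simp [Matrix.smul_single]
  rw [h2]
  refine Finset.aestronglyMeasurable_fun_sum _ fun k _ =>
    Finset.aestronglyMeasurable_fun_sum _ fun l _ => ?_
  exact ((hψ _ k l).aestronglyMeasurable).smul aestronglyMeasurable_const

/-- The algebra of random `d × d` matrices: measurable maps `Ω → Mat d` modulo almost everywhere
equality, with the pointwise operations. -/
abbrev RandomMatrix (μ : Measure Ω) (d : ℕ) : Type _ := Ω →ₘ[μ] Mat d

/-- The operator `a ↦ (ω ↦ ψ ω (a (T ω)))` on random matrices. -/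
def skewOp (ψ : Ω → (Mat d →ₗ[ℂ] Mat d)) (hψ : MeasurableMap ψ) (T : Ω → Ω)
    (hT : MeasurePreserving T μ μ) : RandomMatrix μ d →ₗ[ℂ] RandomMatrix μ d where
  toFun a := AEEqFun.mk (fun ω => ψ ω (a (T ω)))
    (hψ.aestronglyMeasurable_apply
      (a.aestronglyMeasurable.comp_measurePreserving hT))
  map_add' a b := by
    rw [AEEqFun.mk_add_mk, AEEqFun.mk_eq_mk]
    filter_upwards [hT.quasiMeasurePreserving.ae (AEEqFun.coeFn_add a b)] with ω h
    simp [h]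
  map_smul' c a := by
    rw [RingHom.id_apply, AEEqFun.smul_mk, AEEqFun.mk_eq_mk]
    filter_upwards [hT.quasiMeasurePreserving.ae (AEEqFun.coeFn_smul c a)] with ω h
    simp [h]

theorem coeFn_skewOp (ψ : Ω → (Mat d →ₗ[ℂ] Mat d)) (hψ : MeasurableMap ψ) (T : Ω → Ω)
    (hT : MeasurePreserving T μ μ) (a : RandomMatrix μ d) :
    skewOp ψ hψ T hT a =ᵐ[μ] fun ω => ψ ω (a (T ω)) :=
  AEEqFun.coeFn_mk _ _

/-- A linear operator on random matrices which maps `L^p` boundedly into itself. -/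
def IsBoundedOnLp (A : RandomMatrix μ d →ₗ[ℂ] RandomMatrix μ d) (p : ℝ≥0∞) : Prop :=
  ∃ C : ℝ, ∀ f : Lp (Mat d) p μ, ∃ h : A f ∈ Lp (Mat d) p μ,
    ‖(⟨A f, h⟩ : Lp (Mat d) p μ)‖ ≤ C * ‖f‖

/-- The restriction of a linear operator on random matrices to `L^p(Ω; Mat d)`. -/
def restrictLp (A : RandomMatrix μ d →ₗ[ℂ] RandomMatrix μ d) (p : ℝ≥0∞) [Fact (1 ≤ p)]
    (hA : IsBoundedOnLp A p) : Lp (Mat d) p μ →L[ℂ] Lp (Mat d) p μ :=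
  LinearMap.mkContinuousOfExistsBound
    { toFun := fun f => ⟨A f, (hA.choose_spec f).1⟩
      map_add' := fun f g => Subtype.ext (by simp)
      map_smul' := fun c f => Subtype.ext (by
        have : ((c • f : Lp (Mat d) p μ) : RandomMatrix μ d) = c • (f : RandomMatrix μ d) := rfl
        simp only [this, map_smul]
        rfl) }
    ⟨hA.choose, fun f => (hA.choose_spec f).2⟩

theorem coe_restrictLp (A : RandomMatrix μ d →ₗ[ℂ] RandomMatrix μ d) (p : ℝ≥0∞) [Fact (1 ≤ p)]
    (hA : IsBoundedOnLp A p) (f : Lp (Mat d) p μ) :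
    (restrictLp A p hA f : RandomMatrix μ d) = A f := rfl

theorem isBoundedOnLp_skewOp (ψ : Ω → (Mat d →ₗ[ℂ] Mat d)) (hψ : MeasurableMap ψ) (T : Ω → Ω)
    (hT : MeasurePreserving T μ μ) {C : ℝ} (hC : ∀ᵐ ω ∂μ, ∀ a, ‖ψ ω a‖ ≤ C * ‖a‖) (p : ℝ≥0∞) :
    IsBoundedOnLp (skewOp ψ hψ T hT) p := by
  refine ⟨C, fun f => ?_⟩
  have h1 : ∀ᵐ ω ∂μ, ‖(skewOp ψ hψ T hT (f : RandomMatrix μ d)) ω‖ ≤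
      C * ‖(Lp.compMeasurePreserving T hT f) ω‖ := by
    filter_upwards [coeFn_skewOp ψ hψ T hT (f : RandomMatrix μ d), hC,
      Lp.coeFn_compMeasurePreserving f hT] with ω ha hb hc
    rw [ha, hc]
    exact hb _
  have h2 : skewOp ψ hψ T hT (f : RandomMatrix μ d) ∈ Lp (Mat d) p μ :=
    Lp.mem_Lp_of_ae_le_mul h1
  refine ⟨h2, ?_⟩
  rw [← Lp.norm_compMeasurePreserving f hT]
  exact Lp.norm_le_mul_norm_of_ae_le_mul h1

/-- `p` is a random projection: almost surely a nonzero matrix with `p = p * p = pᴴ`. -/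
def IsRandomProjection (p : RandomMatrix μ d) : Prop :=
  ∀ᵐ ω ∂μ, IsStarProjection (p ω) ∧ p ω ≠ 0

/-- `u` is a random unitary. -/
def IsRandomUnitary (u : RandomMatrix μ d) : Prop :=
  ∀ᵐ ω ∂μ, u ω ∈ Matrix.unitaryGroup (Fin d) ℂ

/-- The random projection `p` reduces the operator `A`: if `p * a * p = a`, then
`p * A a * p = A a`. -/
def Reduces (p : RandomMatrix μ d) (A : RandomMatrix μ d →ₗ[ℂ] RandomMatrix μ d) : Prop :=
  ∀ a : RandomMatrix μ d, p * a * p = a → p * A a * p = A a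

/-- The identity is the only random projection which reduces `A`. -/
def IsIrreducibleOp (A : RandomMatrix μ d →ₗ[ℂ] RandomMatrix μ d) : Prop :=
  ∀ p : RandomMatrix μ d, IsRandomProjection p → Reduces p A → p = 1

end Operators

/-- The peripheral eigenvalues of a bounded operator: the eigenvalues which lie in the peripheral
spectrum, that is, in the part of the spectrum whose modulus is the spectral radius. -/
def peripheralEigenvalues {X : Type*} [NormedAddCommGroup X] [NormedSpace ℂ X] (A : X →L[ℂ] X) :
    Set ℂ :=
  {α | (α ∈ spectrum ℂ A ∧ (‖α‖₊ : ℝ≥0∞) = spectralRadius ℂ A) ∧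
    Module.End.HasEigenvalue (A : X →ₗ[ℂ] X) α}

/-- An ergodic quantum process on `Mat d` over `(Ω, μ)`: an invertible ergodic measure preserving
transformation `θ` and a random quantum channel `φ`. -/
structure ErgodicQuantumProcess {Ω : Type*} [MeasurableSpace Ω] (μ : Measure Ω) (d : ℕ) where
  θ : Ω ≃ᵐ Ω
  ergodic : Ergodic θ μ
  φ : Ω → (Mat d →ₗ[ℂ] Mat d)
  measurable : MeasurableMap φ
  channel : ∀ᵐ ω ∂μ, IsQuantumChannel (φ ω)

namespace ErgodicQuantumProcess

variable {Ω : Type*} [MeasurableSpace Ω] {μ : Measure Ω} {d : ℕ} (E : ErgodicQuantumProcess μ d)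

/-- The operator `𝓛(a)_ω = φ_ω (a_{θ⁻¹ ω})` on random matrices. -/
def op : RandomMatrix μ d →ₗ[ℂ] RandomMatrix μ d :=
  skewOp E.φ E.measurable E.θ.symm
    (MeasurePreserving.symm E.θ E.ergodic.toMeasurePreserving)

/-- The dual operator `𝓛†(a)_ω = φ_{θ ω}† (a_{θ ω})` on random matrices. -/
def dualOp : RandomMatrix μ d →ₗ[ℂ] RandomMatrix μ d :=
  skewOp (fun ω => hsAdjoint (E.φ (E.θ ω))) (E.measurable.hsAdjoint.comp E.θ.measurable) E.θ
    E.ergodic.toMeasurePreserving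

/-- The process is irreducible. -/
def IsIrreducible : Prop := IsIrreducibleOp E.op

theorem isBoundedOnLp_op (p : ℝ≥0∞) : IsBoundedOnLp E.op p :=
  isBoundedOnLp_skewOp _ _ _ _ (E.channel.mono fun _ h a => h.norm_le a) p

theorem isBoundedOnLp_dualOp (p : ℝ≥0∞) : IsBoundedOnLp E.dualOp p :=
  isBoundedOnLp_skewOp _ _ _ _
    ((E.ergodic.toMeasurePreserving.quasiMeasurePreserving.ae E.channel).mono fun _ h b =>
      norm_hsAdjoint_le (fun a => h.norm_le a) b) p

/-- `𝓛` as a bounded operator on `L¹(Ω; Mat d)`. -/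
def opL1 : Lp (Mat d) 1 μ →L[ℂ] Lp (Mat d) 1 μ := restrictLp E.op 1 (E.isBoundedOnLp_op 1)

/-- `𝓛†` as a bounded operator on `L^∞(Ω; Mat d)`. -/
def dualOpLinfty : Lp (Mat d) ∞ μ →L[ℂ] Lp (Mat d) ∞ μ :=
  restrictLp E.dualOp ∞ (E.isBoundedOnLp_dualOp ∞)

end ErgodicQuantumProcess

end QuantumProcess

end

/-! Each dual map `hsAdjoint (φ ω)` is unital and completely positive, hence a contraction. If `𝓛†x
= αx` with `|α| = 1`, then `‖x ω‖ ≤ ‖x (θ ω)‖`, and ergodicity makes the norm constant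
(`ae_const_of_le_comp`); scale it to one. The Schwarz inequality says that `z = 1 - xᴴx` satisfies
`φ_ω†(z_ω) ≤ z_{θ⁻¹ω}`, so the projection onto `ker z`, nonzero because `‖x‖ = 1`, reduces `𝓛`.
Irreducibility forces `z = 0`: `x` is unitary (`isRandomUnitary_of_norm_eq_one`).

Unitary eigenvectors give equality in the Schwarz inequality and so lie in the multiplicative
domain. Hence `uᴴv` is an eigenvector for `ᾱβ` (`dualOp_star_mul`), and the unimodular eigenvalues
of `𝓛†` form a group.

On square integrable matrices with the Hilbert–Schmidt product, `𝓛` and `𝓛†` are mutually adjoint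
and power bounded. A mean ergodic argument (`exists_adjoint_eigenvector`) turns an eigenvalue of one
into the conjugate eigenvalue of the other, and the group property removes the conjugate. Unimodular
eigenvectors of either operator are bounded, so the choice of `L^p` does not affect them; power
boundedness and a fixed point make both spectral radii one. -/

noncomputable section

namespace QuantumProcess

/-! ### Kraus operators, the Schwarz inequality and the multiplicative domain -/

section Kraus

variable {d : ℕ}

theorem exists_eq_star_mul_self {A : Type*} [NonUnitalCStarAlgebra A] [PartialOrder A]
    [StarOrderedRing A] (a : A) (ha : 0 ≤ a) : ∃ b, a = star b * b :=
  CStarAlgebra.nonneg_iff_eq_star_mul_self.mp ha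

/-- Every quantum channel has a Kraus decomposition. -/
theorem IsQuantumChannel.exists_kraus {φ : Mat d →ₗ[ℂ] Mat d} (hφ : IsQuantumChannel φ) :
    ∃ K : Fin d × Fin d → Mat d,
      (∀ a, φ a = ∑ k, K k * a * (K k)ᴴ) ∧ ∑ k, (K k)ᴴ * K k = 1 := by
  obtain ⟨⟨Φ, rfl⟩, htr⟩ := hφ
  rcases d with _ | n
  · exact ⟨0, fun a => Subsingleton.elim _ _, Subsingleton.elim _ _⟩
  -- `star R * R` is the block matrix of matrix units, so its image under `Φ` is the Choi matrix,
  -- positive by complete positivity.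
  let R : CStarMatrix (Fin (n + 1)) (Fin (n + 1)) (Mat (n + 1)) :=
    CStarMatrix.ofMatrix (Matrix.of fun k j => if k = 0 then Matrix.single 0 j 1 else 0)
  have hR : ∀ i j, (star R * R) i j = Matrix.single i j (1 : ℂ) := by
    intro i j
    rw [CStarMatrix.mul_apply]
    simp only [CStarMatrix.star_apply]
    rw [Finset.sum_eq_single 0]
    · simp [R, Matrix.star_eq_conjTranspose, Matrix.conjTranspose_single]
    · intro k _ hk
      simp [R, hk]
    · simp
  have hpos := Φ.map_cstarMatrix_nonneg' _ _ (star_mul_self_nonneg R)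
  obtain ⟨B, hB⟩ := exists_eq_star_mul_self _ hpos
  have hΦ : ∀ i j, Φ.toLinearMap (Matrix.single i j 1) = ∑ k, (B k i)ᴴ * B k j := by
    intro i j
    have h := congrFun (congrFun hB i) j
    rw [CStarMatrix.map_apply, hR, CStarMatrix.mul_apply] at h
    simpa [CStarMatrix.star_apply, Matrix.star_eq_conjTranspose] using h
  -- One Kraus operator for each scalar row of the square root `B` of the Choi matrix.
  let K : Fin (n + 1) × Fin (n + 1) → Mat (n + 1) := fun k =>
    Matrix.of fun s i => star (B k.1 i k.2 s)
  have hK : ∀ a, Φ.toLinearMap a = ∑ k, K k * a * (K k)ᴴ := by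
    intro a
    let χ : Mat (n + 1) →ₗ[ℂ] Mat (n + 1) :=
      ∑ k, (LinearMap.mulLeft ℂ (K k)).comp (LinearMap.mulRight ℂ ((K k)ᴴ))
    have hχ : Φ.toLinearMap = χ := by
      refine Matrix.ext_linearMap _ fun i j => LinearMap.ext_ring ?_
      have h1 : ∀ k s t, (K k * (Matrix.single i j (1 : ℂ) * (K k)ᴴ) : Mat (n + 1)) s t =
          star (B k.1 i k.2 s) * B k.1 j k.2 t := by
        intro k s t
        rw [Matrix.mul_apply, Finset.sum_eq_single i]
        · simp [K]
        · intro l _ hl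
          simp [Matrix.single_mul_apply_of_ne, hl]
        · simp
      ext s t
      change Φ.toLinearMap (Matrix.single i j 1) s t = χ (Matrix.single i j 1) s t
      rw [hΦ]
      simp only [LinearMap.comp_apply, χ, LinearMap.sum_apply,
        LinearMap.mulLeft_apply, LinearMap.mulRight_apply, Matrix.sum_apply, h1,
        Fintype.sum_prod_type]
      simp [Matrix.mul_apply]
    rw [hχ]
    simp [χ, Matrix.mul_assoc]
  refine ⟨K, hK, ?_⟩
  have h : ∀ a, (a * ∑ k, (K k)ᴴ * K k).trace = (a * 1).trace := by
    intro a
    rw [mul_one, ← htr a, hK, Finset.mul_sum, Matrix.trace_sum, Matrix.trace_sum]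
    refine Finset.sum_congr rfl fun k _ => ?_
    rw [← Matrix.mul_assoc, Matrix.trace_mul_comm, ← Matrix.mul_assoc]
  ext i j
  have := h (Matrix.single j i 1)
  rwa [Matrix.trace_single_mul, Matrix.trace_single_mul, one_smul, one_smul] at this

theorem hsAdjoint_eq_of_kraus {ι : Type*} [Fintype ι] {φ : Mat d →ₗ[ℂ] Mat d} {K : ι → Mat d}
    (hK : ∀ a, φ a = ∑ k, K k * a * (K k)ᴴ) (b : Mat d) :
    hsAdjoint φ b = ∑ k, (K k)ᴴ * b * K k := by
  let χ : Mat d →ₗ[ℂ] Mat d :=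
    ∑ k, (LinearMap.mulLeft ℂ ((K k)ᴴ)).comp (LinearMap.mulRight ℂ (K k))
  have hχ : ∀ b, χ b = ∑ k, (K k)ᴴ * b * K k := fun b => by
    simp [χ, Matrix.mul_assoc]
  rw [← hχ, ← hsAdjoint_unique φ χ]
  intro a b
  rw [hχ, hK, Matrix.conjTranspose_sum, Finset.mul_sum, Finset.sum_mul, Matrix.trace_sum,
    Matrix.trace_sum]
  refine Finset.sum_congr rfl fun k _ => ?_
  simp only [Matrix.conjTranspose_mul, Matrix.conjTranspose_conjTranspose]
  rw [← Matrix.mul_assoc, Matrix.trace_mul_comm]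
  simp only [Matrix.mul_assoc]

/-- The defect in the Schwarz inequality for the adjoint of a channel. -/
theorem schwarz_defect {ι : Type*} [Fintype ι] {K : ι → Mat d} (hK : ∑ k, (K k)ᴴ * K k = 1)
    (x : Mat d) :
    ∑ k, (x * K k - K k * ∑ l, (K l)ᴴ * x * K l)ᴴ * (x * K k - K k * ∑ l, (K l)ᴴ * x * K l) =
      ∑ k, (K k)ᴴ * (xᴴ * x) * K k -
        (∑ l, (K l)ᴴ * x * K l)ᴴ * ∑ l, (K l)ᴴ * x * K l := by
  set y := ∑ l, (K l)ᴴ * x * K l with hy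
  have hyH : yᴴ = ∑ l, (K l)ᴴ * xᴴ * K l := by
    simp [hy, Matrix.conjTranspose_sum, Matrix.conjTranspose_mul, Matrix.mul_assoc]
  have h : ∀ k, (x * K k - K k * y)ᴴ * (x * K k - K k * y) =
      (K k)ᴴ * (xᴴ * x) * K k - ((K k)ᴴ * xᴴ * K k) * y - yᴴ * ((K k)ᴴ * x * K k) +
        yᴴ * ((K k)ᴴ * K k) * y := by
    intro k
    simp only [Matrix.conjTranspose_sub, Matrix.conjTranspose_mul]
    noncomm_ring
  -- After summation the last three terms are `-yᴴy`, `-yᴴy` and `+yᴴy`.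
  simp only [h, Finset.sum_add_distrib, Finset.sum_sub_distrib, ← Finset.sum_mul,
    ← Finset.mul_sum, hK, ← hyH, ← hy]
  noncomm_ring

theorem schwarz {ι : Type*} [Fintype ι] {K : ι → Mat d} (hK : ∑ k, (K k)ᴴ * K k = 1)
    (x : Mat d) :
    (∑ l, (K l)ᴴ * x * K l)ᴴ * ∑ l, (K l)ᴴ * x * K l ≤ ∑ k, (K k)ᴴ * (xᴴ * x) * K k := by
  rw [← sub_nonneg, ← schwarz_defect hK]
  exact Finset.sum_nonneg fun k _ => star_mul_self_nonneg _

theorem conjTranspose_mul_self_nonneg (x : Mat d) : 0 ≤ xᴴ * x :=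
  star_mul_self_nonneg x

/-- The defect is a sum of positive terms, so equality kills each of them. This intertwining
relation is the source of multiplicativity. -/
theorem mul_kraus_of_schwarz_eq {ι : Type*} [Fintype ι] {K : ι → Mat d}
    (hK : ∑ k, (K k)ᴴ * K k = 1) {x : Mat d}
    (hx : (∑ l, (K l)ᴴ * x * K l)ᴴ * ∑ l, (K l)ᴴ * x * K l = ∑ k, (K k)ᴴ * (xᴴ * x) * K k)
    (k : ι) : x * K k = K k * ∑ l, (K l)ᴴ * x * K l := by
  have h := schwarz_defect hK x
  rw [hx, sub_self, Finset.sum_eq_zero_iff_of_nonneg fun k _ => conjTranspose_mul_self_nonneg _] at h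
  exact sub_eq_zero.mp (CStarRing.star_mul_self_eq_zero_iff _ |>.mp (h k (Finset.mem_univ k)))

/-- Combine the Schwarz inequality with `xᴴx ≤ ‖x‖²` and unitality. -/
theorem norm_kraus_dual_le {ι : Type*} [Fintype ι] {K : ι → Mat d}
    (hK : ∑ k, (K k)ᴴ * K k = 1) (x : Mat d) : ‖∑ l, (K l)ᴴ * x * K l‖ ≤ ‖x‖ := by
  set y := ∑ l, (K l)ᴴ * x * K l with hy
  have h1 : yᴴ * y ≤ algebraMap ℝ (Mat d) (‖x‖ ^ 2) := by
    refine (schwarz hK x).trans ?_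
    have h2 : xᴴ * x ≤ algebraMap ℝ (Mat d) (‖x‖ ^ 2) :=
      CStarAlgebra.star_mul_le_algebraMap_norm_sq
    calc ∑ k, (K k)ᴴ * (xᴴ * x) * K k
        ≤ ∑ k, (K k)ᴴ * algebraMap ℝ (Mat d) (‖x‖ ^ 2) * K k :=
          Finset.sum_le_sum fun k _ => star_left_conjugate_le_conjugate h2 (K k)
      _ = algebraMap ℝ (Mat d) (‖x‖ ^ 2) := by
          rw [Algebra.algebraMap_eq_smul_one]
          simp only [mul_smul_comm, smul_mul_assoc, mul_one, ← Finset.smul_sum, hK]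
  have h3 : ‖yᴴ * y‖ ≤ ‖x‖ ^ 2 := by
    -- For `d = 0` the identity has norm zero, so `norm_algebraMap'` is not available.
    rcases d with _ | n
    · rw [Subsingleton.elim (yᴴ * y) 0, norm_zero]; positivity
    refine (CStarAlgebra.norm_le_norm_of_nonneg_of_le (star_mul_self_nonneg y) h1).trans ?_
    rw [norm_algebraMap', Real.norm_of_nonneg (by positivity)]
  rw [Matrix.l2_opNorm_conjTranspose_mul_self] at h3
  nlinarith [norm_nonneg x, norm_nonneg y]

theorem IsQuantumChannel.norm_hsAdjoint_le {φ : Mat d →ₗ[ℂ] Mat d} (hφ : IsQuantumChannel φ)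
    (b : Mat d) : ‖hsAdjoint φ b‖ ≤ ‖b‖ := by
  obtain ⟨K, hK, h1⟩ := hφ.exists_kraus
  rw [hsAdjoint_eq_of_kraus hK]
  exact norm_kraus_dual_le h1 b

theorem IsQuantumChannel.hsAdjoint_one {φ : Mat d →ₗ[ℂ] Mat d} (hφ : IsQuantumChannel φ) :
    hsAdjoint φ 1 = 1 := by
  obtain ⟨K, hK, h1⟩ := hφ.exists_kraus
  simp [hsAdjoint_eq_of_kraus hK, h1]

/-- A unitary which the adjoint of a channel maps to a unitary is in the multiplicative domain. -/
theorem IsQuantumChannel.hsAdjoint_mul {φ : Mat d →ₗ[ℂ] Mat d} (hφ : IsQuantumChannel φ)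
    {u : Mat d} (hu : uᴴ * u = 1) (hu' : (hsAdjoint φ u)ᴴ * hsAdjoint φ u = 1) (b : Mat d) :
    hsAdjoint φ (uᴴ * b) = (hsAdjoint φ u)ᴴ * hsAdjoint φ b := by
  obtain ⟨K, hK, h1⟩ := hφ.exists_kraus
  simp only [hsAdjoint_eq_of_kraus hK] at hu' ⊢
  -- Both sides of the Schwarz inequality equal `1`.
  have h := mul_kraus_of_schwarz_eq h1 (x := u) (by rw [hu', hu]; simp [h1])
  rw [Finset.mul_sum]
  refine Finset.sum_congr rfl fun k _ => ?_
  have h2 := congrArg Matrix.conjTranspose (h k)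
  simp only [Matrix.conjTranspose_mul (M := u), Matrix.conjTranspose_mul (M := K k)] at h2
  rw [← Matrix.mul_assoc, ← Matrix.mul_assoc, ← Matrix.mul_assoc, h2]

/-- If the adjoint of a channel maps `z ≥ 0` below `z'`, the projection `q'` is orthogonal to `z'`,
and `q` is the projection onto the kernel of `z`, then the channel maps the corner of `q'` into that
of `q`. -/
theorem IsQuantumChannel.corner {φ : Mat d →ₗ[ℂ] Mat d} (hφ : IsQuantumChannel φ)
    {z z' q q' : Mat d} (hz : 0 ≤ z) (hzz : hsAdjoint φ z ≤ z') (hzq : z' * q' = 0)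
    (hq' : q'ᴴ = q') (hq : qᴴ = q) (hker : ∀ v : Mat d, z * v = 0 → q * v = v) {a : Mat d}
    (ha : q' * a * q' = a) : q * φ a * q = φ a := by
  obtain ⟨K, hK, h1⟩ := hφ.exists_kraus
  rw [hsAdjoint_eq_of_kraus hK] at hzz
  obtain ⟨r, rfl⟩ := CStarAlgebra.nonneg_iff_eq_star_mul_self.mp hz
  -- Compressing the inequality by `q'` kills its right side. Hence every `r * K k * q'` vanishes,
  -- and `K k` maps the range of `q'` into `ker z`.
  have h2 : ∑ k, (r * K k * q')ᴴ * (r * K k * q') = 0 := by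
    apply le_antisymm
    · have h3 := star_left_conjugate_le_conjugate hzz q'
      rw [Matrix.mul_assoc (star q') z', hzq, mul_zero, Finset.mul_sum, Finset.sum_mul] at h3
      refine le_of_eq_of_le (Finset.sum_congr rfl fun k _ => ?_) h3
      simp only [Matrix.conjTranspose_mul, Matrix.star_eq_conjTranspose, Matrix.mul_assoc]
    · exact Finset.sum_nonneg fun k _ => star_mul_self_nonneg _
  rw [Finset.sum_eq_zero_iff_of_nonneg fun k _ => conjTranspose_mul_self_nonneg _] at h2
  have h3 : ∀ k, q * (K k * q') = K k * q' := fun k => by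
    apply hker
    have h4 := CStarRing.star_mul_self_eq_zero_iff _ |>.mp (h2 k (Finset.mem_univ k))
    rw [Matrix.mul_assoc (star r), ← Matrix.mul_assoc r, h4, mul_zero]
  have h4 : ∀ k, q' * (K k)ᴴ * q = q' * (K k)ᴴ := fun k => by
    have := congrArg Matrix.conjTranspose (h3 k)
    simpa [Matrix.conjTranspose_mul, hq, hq'] using this
  rw [hK, Finset.mul_sum, Finset.sum_mul]
  refine Finset.sum_congr rfl fun k _ => ?_
  rw [← ha]
  calc q * (K k * (q' * a * q') * (K k)ᴴ) * q
      = (q * (K k * q')) * a * (q' * (K k)ᴴ * q) := by simp only [Matrix.mul_assoc]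
    _ = _ := by rw [h3, h4]; simp only [Matrix.mul_assoc]

end Kraus

/-! ### Ergodicity, mean ergodic argument and peripheral spectrum -/

section Abstract

/-- The increment along `T` is nonnegative with integral zero, so the function is invariant.
Composing with `arctan` supplies integrability, which is not assumed. -/
theorem ae_const_of_le_comp {Ω : Type*} [MeasurableSpace Ω] {μ : Measure Ω}
    [IsProbabilityMeasure μ] {T : Ω → Ω} (hT : Ergodic T μ) {f : Ω → ℝ} (hf : AEMeasurable f μ)
    (h : ∀ᵐ ω ∂μ, f ω ≤ f (T ω)) : ∃ c, ∀ᵐ ω ∂μ, f ω = c := by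
  let g : Ω → ℝ := fun ω => Real.arctan (f ω)
  have hg : AEStronglyMeasurable g μ :=
    (Real.measurable_arctan.comp_aemeasurable hf).aestronglyMeasurable
  have hgi : Integrable g μ := by
    refine Integrable.of_bound hg (Real.pi / 2) (Filter.Eventually.of_forall fun ω => ?_)
    rw [Real.norm_eq_abs, abs_le]
    exact ⟨(Real.neg_pi_div_two_lt_arctan _).le, (Real.arctan_lt_pi_div_two _).le⟩
  have hgT : Integrable (fun ω => g (T ω)) μ :=
    hT.toMeasurePreserving.integrable_comp_of_integrable hgi
  have hint : ∫ ω, g (T ω) ∂μ = ∫ ω, g ω ∂μ := by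
    have h1 := hT.toMeasurePreserving.map_eq
    conv_rhs => rw [← h1]
    rw [integral_map hT.measurable.aemeasurable (by rwa [h1])]
  have h0 : ∀ᵐ ω ∂μ, g (T ω) - g ω = 0 := by
    have h1 : 0 ≤ᵐ[μ] fun ω => g (T ω) - g ω := by
      filter_upwards [h] with ω hω
      exact sub_nonneg.mpr (Real.arctan_mono hω)
    refine (integral_eq_zero_iff_of_nonneg_ae h1 (hgT.sub hgi)).mp ?_
    rw [integral_sub hgT hgi, hint, sub_self]
  obtain ⟨c, hc⟩ := hT.ae_eq_const_of_ae_eq_comp_ae hg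
    (h0.mono fun ω hω => sub_eq_zero.mp hω)
  refine ⟨Real.tan c, hc.mono fun ω hω => ?_⟩
  rw [← Real.tan_arctan (f ω)]
  exact congrArg Real.tan hω

/-- If a power bounded operator on a Hilbert space has a unimodular eigenvalue, then the conjugate
is an eigenvalue of the adjoint. -/
theorem exists_adjoint_eigenvector {H : Type*} [NormedAddCommGroup H] [InnerProductSpace ℂ H]
    [CompleteSpace H] {P : H →L[ℂ] H} {C : ℝ} (hP : ∀ n : ℕ, ‖P ^ n‖ ≤ C) {α : ℂ} (hα : ‖α‖ = 1)
    {w : H} (hw : w ≠ 0) (hPw : P w = α • w) :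
    ∃ z ≠ 0, ContinuousLinearMap.adjoint P z = star α • z := by
  have hαα : star α * α = 1 := by
    rw [RCLike.star_def, RCLike.conj_mul, hα]; simp
  let S : H →L[ℂ] H := star α • P
  have hS : ∀ n x, ‖(S ^ n) x‖ ≤ C * ‖x‖ := by
    intro n x
    rw [smul_pow, smul_apply, norm_smul, norm_pow, norm_star, hα, one_pow,
      one_mul]
    exact ((P ^ n).le_opNorm x).trans (by gcongr; exact hP n)
  have hSw : S w = w := by
    rw [smul_apply, hPw, smul_smul, hαα, one_smul]
  by_contra! hz
  -- Without the required eigenvector, the adjoint of `1 - S` is injective, so `1 - S` has dense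
  -- range and the fixed vector `w` of `S` is nearly a coboundary `v = y - S y`.
  let D : H →L[ℂ] H := 1 - S
  have hker : D.rangeᗮ = ⊥ := by
    rw [ContinuousLinearMap.orthogonal_range, Submodule.eq_bot_iff]
    intro z hzD
    by_contra hz0
    refine hz z hz0 ?_
    have h1 : z - α • ContinuousLinearMap.adjoint P z = 0 := by
      have : ContinuousLinearMap.adjoint D z = 0 := hzD
      simpa [D, S, map_sub, ← ContinuousLinearMap.star_eq_adjoint, star_smul] using this
    rw [sub_eq_zero] at h1
    conv_rhs => rw [h1, smul_smul, hαα, one_smul]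
  have hdense : D.range.topologicalClosure = ⊤ :=
    (Submodule.topologicalClosure_eq_top_iff).mpr hker
  have hC : 0 ≤ C := (norm_nonneg _).trans (hP 0)
  have hwpos : 0 < ‖w‖ := norm_pos_iff.mpr hw
  have hwc : w ∈ closure (D.range : Set H) := by
    rw [← Submodule.topologicalClosure_coe, hdense]; trivial
  obtain ⟨v, ⟨y, hy⟩, hv⟩ := Metric.mem_closure_iff.mp hwc (‖w‖ / (2 * (C + 1))) (by positivity)
  -- Summing the first `n` iterates gives `n • w`, while those of `v` telescope to a bounded vector
  -- and those of `w - v` have norm at most `‖w‖ / 2` each. Linear growth then contradicts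
  -- boundedness.
  have hbound : ∀ n : ℕ, n * (‖w‖ / 2) ≤ (C + 1) * ‖y‖ := by
    intro n
    have h1 : ∑ k ∈ Finset.range n, (S ^ k) w = (n : ℂ) • w := by
      have : ∀ k, (S ^ k) w = w := fun k => by
        induction k with
        | zero => simp
        | succ k ih => rw [pow_succ, mul_apply_eq_comp, hSw, ih]
      simp [this, Nat.cast_smul_eq_nsmul]
    have h2 : ∑ k ∈ Finset.range n, (S ^ k) v = y - (S ^ n) y := by
      have h3 : v = y - S y := by rw [← hy]; simp [D]
      have : ∀ k, (S ^ k) v = (S ^ k) y - (S ^ (k + 1)) y := fun k => by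
        rw [h3, map_sub, pow_succ]; rfl
      simp only [this, Finset.sum_range_sub', pow_zero, one_apply_eq_self]
    have h4 : (n : ℂ) • w = ∑ k ∈ Finset.range n, (S ^ k) (w - v) + (y - (S ^ n) y) := by
      simp only [map_sub, Finset.sum_sub_distrib, h1, h2]; abel
    have h5 : ‖∑ k ∈ Finset.range n, (S ^ k) (w - v)‖ ≤ n * (‖w‖ / 2) := by
      refine (norm_sum_le _ _).trans ?_
      have : ∀ k ∈ Finset.range n, ‖(S ^ k) (w - v)‖ ≤ ‖w‖ / 2 := fun k _ => by
        refine (hS k _).trans ?_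
        rw [← dist_eq_norm]
        calc C * dist w v ≤ (C + 1) * (‖w‖ / (2 * (C + 1))) := by gcongr; linarith
          _ = ‖w‖ / 2 := by field_simp
      refine (Finset.sum_le_sum this).trans ?_
      simp
    have h6 : ‖y - (S ^ n) y‖ ≤ (C + 1) * ‖y‖ := by
      refine (norm_sub_le _ _).trans ?_
      linarith [hS n y]
    have h7 : (n : ℝ) * ‖w‖ = ‖(n : ℂ) • w‖ := by rw [norm_smul]; simp
    have h8 := norm_add_le (∑ k ∈ Finset.range n, (S ^ k) (w - v)) (y - (S ^ n) y)
    rw [← h4, ← h7] at h8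
    linarith
  obtain ⟨n, hn⟩ := exists_nat_gt ((C + 1) * ‖y‖ / (‖w‖ / 2))
  rw [div_lt_iff₀ (by positivity)] at hn
  exact absurd (hbound n) (not_le.mpr hn)

theorem spectralRadius_le_one_of_power_bounded {A : Type*} [NormedRing A] [NormedAlgebra ℂ A]
    [CompleteSpace A] {a : A} {C : ℝ} (ha : ∀ n : ℕ, ‖a ^ n‖ ≤ C) : spectralRadius ℂ a ≤ 1 := by
  have h1 := spectrum.pow_norm_pow_one_div_tendsto_nhds_spectralRadius a
  -- Gelfand's formula is compared with `(C + 1) ^ (1 / n)`; the added one keeps the base nonzero,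
  -- as continuity at exponent zero requires.
  have h2 : Filter.Tendsto (fun n : ℕ => ENNReal.ofReal ((C + 1) ^ (1 / n : ℝ))) Filter.atTop
      (nhds 1) := by
    rw [← ENNReal.ofReal_one]
    refine (ENNReal.continuous_ofReal.tendsto _).comp ?_
    have hC : 0 ≤ C := (norm_nonneg _).trans (ha 0)
    have := (Real.continuousAt_const_rpow (a := C + 1) (b := 0) (by linarith)).tendsto.comp
      tendsto_one_div_atTop_nhds_zero_nat
    simpa [Function.comp_def] using this
  refine le_of_tendsto_of_tendsto' h1 h2 fun n => ?_
  refine ENNReal.ofReal_le_ofReal ?_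
  exact Real.rpow_le_rpow (norm_nonneg _) ((ha n).trans (by linarith)) (by positivity)

theorem mem_spectrum_of_hasEigenvalue {X : Type*} [NormedAddCommGroup X] [NormedSpace ℂ X]
    {A : X →L[ℂ] X} {α : ℂ} {x : X} (hx : x ≠ 0) (h : A x = α • x) : α ∈ spectrum ℂ A := by
  intro hu
  obtain ⟨b, hb⟩ := hu.exists_left_inv
  have h1 : (b * (algebraMap ℂ (X →L[ℂ] X) α - A)) x = x := by rw [hb]; rfl
  rw [mul_apply_eq_comp, sub_apply, h,
    Algebra.algebraMap_eq_smul_one] at h1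
  simp only [smul_apply, one_apply_eq_self, sub_self,
    map_zero] at h1
  exact hx h1.symm

/-- The peripheral eigenvalues of a power bounded operator with a fixed point. -/
theorem peripheralEigenvalues_eq {X : Type*} [NormedAddCommGroup X] [NormedSpace ℂ X]
    [CompleteSpace X] {A : X →L[ℂ] X} {C : ℝ} (hA : ∀ n : ℕ, ‖A ^ n‖ ≤ C) {x₀ : X}
    (hx₀ : x₀ ≠ 0) (h₀ : A x₀ = x₀) :
    peripheralEigenvalues A = {α : ℂ | ‖α‖ = 1 ∧ ∃ x, x ≠ 0 ∧ A x = α • x} := by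
  -- Power boundedness gives the upper bound, the fixed point the lower one.
  have hr : spectralRadius ℂ A = 1 := by
    refine le_antisymm (spectralRadius_le_one_of_power_bounded hA) ?_
    have h1 : (1 : ℂ) ∈ spectrum ℂ A := mem_spectrum_of_hasEigenvalue hx₀ (by rw [one_smul, h₀])
    have : (‖(1 : ℂ)‖₊ : ℝ≥0∞) ≤ spectralRadius ℂ A := le_iSup₂ (α := ℝ≥0∞) 1 h1
    simpa using this
  ext α
  have hn : (‖α‖₊ : ℝ≥0∞) = 1 ↔ ‖α‖ = 1 := by
    rw [ENNReal.coe_eq_one, ← NNReal.coe_inj, coe_nnnorm, NNReal.coe_one]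
  simp only [peripheralEigenvalues, Set.mem_ofPred_eq, hr, hn]
  constructor
  · rintro ⟨⟨_, h1⟩, h2⟩
    obtain ⟨x, hx⟩ := h2.exists_hasEigenvector
    exact ⟨h1, x, hx.2, hx.apply_eq_smul⟩
  · rintro ⟨h1, x, hx, hAx⟩
    exact ⟨⟨mem_spectrum_of_hasEigenvalue hx hAx, h1⟩,
      Module.End.hasEigenvalue_of_hasEigenvector
        (Module.End.hasEigenvector_iff.mpr ⟨Module.End.mem_eigenspace_iff.mpr hAx, hx⟩)⟩

end Abstract

/-! ### Spectral projections as limits of powers -/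

section PowerLimit

variable {d : ℕ}

open scoped ComplexOrder in
-- In an eigenbasis the eigenvalues lie in `[0, 1]`, so their powers tend to `0` or stay at `1`.
theorem exists_tendsto_pow {y : Mat d} (hy : 0 ≤ y) (hy1 : ‖y‖ ≤ 1) :
    ∃ q, Filter.Tendsto (fun n : ℕ => y ^ n) Filter.atTop (nhds q) := by
  have hH : y.IsHermitian := (IsSelfAdjoint.of_nonneg hy)
  have hps : y.PosSemidef := Matrix.nonneg_iff_posSemidef.mp hy
  set U := hH.eigenvectorUnitary
  have hpow : ∀ n : ℕ, y ^ n = Unitary.conjStarAlgAut ℂ _ U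
      (Matrix.diagonal fun i => ((hH.eigenvalues i : ℝ) : ℂ) ^ n) := by
    intro n
    conv_lhs => rw [hH.spectral_theorem]
    rw [← map_pow, Matrix.diagonal_pow]
    rfl
  have h1 : ∀ i, hH.eigenvalues i ≤ 1 := by
    intro i
    have : NeZero d := ⟨by rintro rfl; exact i.elim0⟩
    have h2 := spectrum.norm_le_norm_of_mem (𝕜 := ℝ) (hH.eigenvalues_mem_spectrum_real i)
    exact (le_abs_self _).trans (h2.trans hy1)
  have h2 : ∀ i, ∃ l : ℂ, Filter.Tendsto (fun n : ℕ => ((hH.eigenvalues i : ℝ) : ℂ) ^ n)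
      Filter.atTop (nhds l) := by
    intro i
    rcases (h1 i).lt_or_eq with h | h
    · refine ⟨0, tendsto_pow_atTop_nhds_zero_of_norm_lt_one ?_⟩
      rw [Complex.norm_real, Real.norm_of_nonneg (hps.eigenvalues_nonneg i)]
      exact h
    · exact ⟨1, by simp [h]⟩
  choose l hl using h2
  refine ⟨Unitary.conjStarAlgAut ℂ _ U (Matrix.diagonal l), ?_⟩
  simp only [hpow]
  have hc : Continuous (Unitary.conjStarAlgAut ℂ (Mat d) U) := by
    have : ⇑(Unitary.conjStarAlgAut ℂ (Mat d) U) = fun x => (U : Mat d) * x * star (U : Mat d) :=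
      funext fun x => Unitary.conjStarAlgAut_apply U x
    rw [this]
    fun_prop
  refine (hc.tendsto _).comp ?_
  exact ((Continuous.matrix_diagonal continuous_id).tendsto l).comp (tendsto_pi_nhds.mpr hl)

/-- The limit of the powers of a positive contraction of norm one is the nonzero projection onto
the fixed vectors. -/
theorem tendsto_pow_props {y q : Mat d} (hy : 0 ≤ y) (hy1 : ‖y‖ = 1)
    (hq : Filter.Tendsto (fun n : ℕ => y ^ n) Filter.atTop (nhds q)) :
    IsStarProjection q ∧ q ≠ 0 ∧ y * q = q ∧ ∀ v : Mat d, y * v = v → q * v = v := by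
  have hsa : IsSelfAdjoint y := IsSelfAdjoint.of_nonneg hy
  have hyq : y * q = q := by
    refine tendsto_nhds_unique (f := fun n : ℕ => y ^ (n + 1)) ?_
      (hq.comp (Filter.tendsto_add_atTop_nat 1))
    simp only [pow_succ']
    exact hq.const_mul y
  have hfix : ∀ v : Mat d, y * v = v → q * v = v := fun v hv => by
    have h1 : ∀ n : ℕ, y ^ n * v = v := fun n => by
      induction n with
      | zero => simp
      | succ n ih => rw [pow_succ, mul_assoc, hv, ih]
    refine tendsto_nhds_unique (hq.mul_const v) ?_
    simp [h1]
  refine ⟨⟨hfix q hyq, ?_⟩, ?_, hyq, hfix⟩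
  · have h1 := (continuous_star.tendsto q).comp hq
    refine tendsto_nhds_unique h1 (hq.congr fun n => ?_)
    exact ((hsa.pow n).star_eq).symm
  · rintro rfl
    -- The C⋆-identity for self-adjoint elements preserves norm one along repeated squaring, so the
    -- limit cannot be zero.
    have h2 : ∀ n : ℕ, ‖y ^ 2 ^ n‖ = 1 := fun n => by
      have := hsa.nnnorm_pow_two_pow n
      rw [← coe_nnnorm, this]; simp [hy1]
    have h3 : Filter.Tendsto (fun n : ℕ => 2 ^ n) Filter.atTop Filter.atTop :=
      tendsto_pow_atTop_atTop_of_one_lt one_lt_two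
    have h4 := (hq.comp h3).norm
    simp only [Function.comp_def, h2, norm_zero] at h4
    exact one_ne_zero (tendsto_nhds_unique tendsto_const_nhds h4)

end PowerLimit

/-! ### The trace norm and its monotonicity under channels -/

section TraceNorm

variable {d : ℕ}

/-- The trace pairing as a map into the dual. -/
def tracePairing (d : ℕ) : Mat d →ₗ[ℂ] (Mat d →L[ℂ] ℂ) :=
  (LinearMap.toContinuousLinearMap : (Mat d →ₗ[ℂ] ℂ) ≃ₗ[ℂ] (Mat d →L[ℂ] ℂ)).toLinearMap ∘ₗ
    (LinearMap.mul ℂ (Mat d)).compr₂ (Matrix.traceLinearMap (Fin d) ℂ ℂ)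

theorem tracePairing_apply (a b : Mat d) : tracePairing d a b = (a * b).trace := rfl

/-- The dual norm (trace norm) of a matrix. -/
def dualNorm (a : Mat d) : ℝ := ‖tracePairing d aᴴ‖

theorem norm_trace_le (y : Mat d) : ‖y.trace‖ ≤ d * ‖y‖ := by
  refine (norm_sum_le _ _).trans ((Finset.sum_le_sum fun i _ => norm_entry_le y i i).trans ?_)
  simp

theorem dualNorm_le (a : Mat d) : dualNorm a ≤ d * ‖a‖ := by
  refine ContinuousLinearMap.opNorm_le_bound _ (by positivity) fun b => ?_
  rw [tracePairing_apply, mul_assoc]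
  refine (norm_trace_le _).trans ?_
  gcongr
  refine (norm_mul_le _ _).trans ?_
  rw [Matrix.l2_opNorm_conjTranspose]

/-- Test the functional on `a` itself: each of the `d ^ 2` entries of the positive matrix `aᴴ * a`
is bounded by its trace. -/
theorem norm_le_dualNorm (a : Mat d) : ‖a‖ ≤ d ^ 2 * dualNorm a := by
  have h1 : ‖a‖ * ‖a‖ ≤ d ^ 2 * ‖(aᴴ * a).trace‖ := by
    rw [← Matrix.l2_opNorm_conjTranspose_mul_self]
    refine (norm_le_sum_entries _).trans ?_
    refine (Finset.sum_le_sum fun i _ => Finset.sum_le_sum fun j _ =>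
      norm_entry_le_trace (conjTranspose_mul_self_nonneg a) i j).trans ?_
    simp [pow_two, mul_assoc]
  have h2 : ‖(aᴴ * a).trace‖ ≤ dualNorm a * ‖a‖ := (tracePairing d aᴴ).le_opNorm a
  rcases (norm_nonneg a).eq_or_lt with h | h
  · rw [← h]; exact mul_nonneg (by positivity) (norm_nonneg _)
  · refine le_of_mul_le_mul_right (h1.trans ?_) h
    rw [mul_assoc]; gcongr

theorem continuous_dualNorm : Continuous (dualNorm (d := d)) := by
  have h : Continuous (tracePairing d) := LinearMap.continuous_of_finiteDimensional _
  exact (h.comp continuous_star).norm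

theorem dualNorm_smul (c : ℂ) (a : Mat d) : dualNorm (c • a) = ‖c‖ * dualNorm a := by
  simp [dualNorm, Matrix.conjTranspose_smul, norm_smul]

theorem dualNorm_nonneg (a : Mat d) : 0 ≤ dualNorm a := norm_nonneg _

/-- By duality from the contractivity of `hsAdjoint φ` in operator norm. -/
theorem IsQuantumChannel.dualNorm_le {φ : Mat d →ₗ[ℂ] Mat d} (hφ : IsQuantumChannel φ)
    (a : Mat d) : dualNorm (φ a) ≤ dualNorm a := by
  refine ContinuousLinearMap.opNorm_le_bound _ (norm_nonneg _) fun b => ?_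
  rw [tracePairing_apply, ← hsAdjoint_spec, ← tracePairing_apply]
  refine ((tracePairing d aᴴ).le_opNorm _).trans ?_
  exact mul_le_mul_of_nonneg_left (hφ.norm_hsAdjoint_le b) (norm_nonneg _)

end TraceNorm

/-- The constants enter once, not once per iterate, since the functional `M` comparable to the norm
does not increase. This allows a change to a norm in which the process contracts. -/
theorem norm_pow_le_of_monotone {X : Type*} [NormedAddCommGroup X] [NormedSpace ℂ X]
    {A : X →L[ℂ] X} {M : X → ℝ} {c c' : ℝ} (hc : 0 ≤ c) (hc' : 0 ≤ c')
    (hM : ∀ f, M (A f) ≤ M f) (h1 : ∀ f, ‖f‖ ≤ c * M f) (h2 : ∀ f, M f ≤ c' * ‖f‖) (n : ℕ) :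
    ‖A ^ n‖ ≤ c * c' := by
  refine ContinuousLinearMap.opNorm_le_bound _ (mul_nonneg hc hc') fun f => ?_
  have h3 : M ((A ^ n) f) ≤ M f := by
    induction n with
    | zero => simp
    | succ n ih => rw [pow_succ', mul_apply_eq_comp]; exact (hM _).trans ih
  calc ‖(A ^ n) f‖ ≤ c * M f := (h1 _).trans (by gcongr)
    _ ≤ c * c' * ‖f‖ := by rw [mul_assoc]; gcongr; exact h2 f

/-! ### Fibrewise eigenvalue equations and boundedness of eigenvectors -/

namespace ErgodicQuantumProcess

variable {Ω : Type*} [MeasurableSpace Ω] {μ : Measure Ω} {d : ℕ} (E : ErgodicQuantumProcess μ d)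

theorem measurePreserving_symm : MeasurePreserving E.θ.symm μ μ :=
  MeasurePreserving.symm E.θ E.ergodic.toMeasurePreserving

theorem ae_comp {p : Ω → Prop} (h : ∀ᵐ ω ∂μ, p ω) : ∀ᵐ ω ∂μ, p (E.θ ω) :=
  E.ergodic.toMeasurePreserving.quasiMeasurePreserving.ae h

theorem ae_comp_symm {p : Ω → Prop} (h : ∀ᵐ ω ∂μ, p ω) : ∀ᵐ ω ∂μ, p (E.θ.symm ω) :=
  E.measurePreserving_symm.quasiMeasurePreserving.ae h

theorem coeFn_op (a : RandomMatrix μ d) : ∀ᵐ ω ∂μ, E.op a ω = E.φ ω (a (E.θ.symm ω)) :=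
  coeFn_skewOp _ _ _ _ a

theorem coeFn_dualOp (a : RandomMatrix μ d) :
    ∀ᵐ ω ∂μ, E.dualOp a ω = hsAdjoint (E.φ (E.θ ω)) (a (E.θ ω)) :=
  coeFn_skewOp _ _ _ _ a

theorem op_eq_smul_iff {x : RandomMatrix μ d} {α : ℂ} :
    E.op x = α • x ↔ ∀ᵐ ω ∂μ, E.φ ω (x (E.θ.symm ω)) = α • x ω := by
  constructor
  · intro h
    filter_upwards [E.coeFn_op x, AEEqFun.coeFn_smul α x] with ω h1 h2
    rw [← h1, h, h2, Pi.smul_apply]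
  · intro h
    apply AEEqFun.ext
    filter_upwards [E.coeFn_op x, AEEqFun.coeFn_smul α x, h] with ω h1 h2 h3
    rw [h1, h2, h3, Pi.smul_apply]

theorem dualOp_eq_smul_iff {x : RandomMatrix μ d} {α : ℂ} :
    E.dualOp x = α • x ↔ ∀ᵐ ω ∂μ, hsAdjoint (E.φ (E.θ ω)) (x (E.θ ω)) = α • x ω := by
  constructor
  · intro h
    filter_upwards [E.coeFn_dualOp x, AEEqFun.coeFn_smul α x] with ω h1 h2
    rw [← h1, h, h2, Pi.smul_apply]
  · intro h
    apply AEEqFun.ext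
    filter_upwards [E.coeFn_dualOp x, AEEqFun.coeFn_smul α x, h] with ω h1 h2 h3
    rw [h1, h2, h3, Pi.smul_apply]

theorem dualOp_one : E.dualOp 1 = 1 := by
  rw [← one_smul ℂ (1 : RandomMatrix μ d), map_smul, one_smul, E.dualOp_eq_smul_iff]
  have h : ∀ᵐ ω ∂μ, (1 : RandomMatrix μ d) ω = 1 := AEEqFun.coeFn_one
  filter_upwards [h, E.ae_comp h, E.ae_comp E.channel] with ω h1 h2 h3
  rw [h1, h2, one_smul, h3.hsAdjoint_one]

theorem exists_norm_eq_of_dualOp [IsProbabilityMeasure μ] {x : RandomMatrix μ d} {α : ℂ}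
    (hα : ‖α‖ = 1) (hx : E.dualOp x = α • x) : ∃ c, ∀ᵐ ω ∂μ, ‖x ω‖ = c := by
  refine ae_const_of_le_comp E.ergodic x.aestronglyMeasurable.norm.aemeasurable ?_
  filter_upwards [E.dualOp_eq_smul_iff.mp hx, E.ae_comp E.channel] with ω h1 h2
  calc ‖x ω‖ = ‖α • x ω‖ := by rw [norm_smul, hα, one_mul]
    _ ≤ ‖x (E.θ ω)‖ := by rw [← h1]; exact h2.norm_hsAdjoint_le _

/-- Channels contract the trace norm, so that norm is monotone along `θ⁻¹` and constant by
ergodicity; the operator norm is only bounded by a multiple of it. -/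
theorem exists_norm_le_of_op [IsProbabilityMeasure μ] {x : RandomMatrix μ d} {α : ℂ}
    (hα : ‖α‖ = 1) (hx : E.op x = α • x) : ∃ c, ∀ᵐ ω ∂μ, ‖x ω‖ ≤ c := by
  obtain ⟨c, hc⟩ := ae_const_of_le_comp (f := fun ω => dualNorm (x ω)) E.ergodic.symm
    (continuous_dualNorm.comp_aestronglyMeasurable x.aestronglyMeasurable).aemeasurable (by
      filter_upwards [E.op_eq_smul_iff.mp hx, E.channel] with ω h1 h2
      calc dualNorm (x ω) = dualNorm (α • x ω) := by rw [dualNorm_smul, hα, one_mul]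
        _ ≤ dualNorm (x (E.θ.symm ω)) := by rw [← h1]; exact h2.dualNorm_le _)
  refine ⟨d ^ 2 * c, hc.mono fun ω h => ?_⟩
  rw [← h]
  exact norm_le_dualNorm _

theorem mem_Lp_of_norm_le [IsFiniteMeasure μ] {x : RandomMatrix μ d} {c : ℝ}
    (h : ∀ᵐ ω ∂μ, ‖x ω‖ ≤ c) (p : ℝ≥0∞) : x ∈ Lp (Mat d) p μ :=
  Lp.mem_Lp_iff_memLp.mpr (MemLp.of_bound x.aestronglyMeasurable c h)

/-! ### Unitarity and products of dual eigenvectors -/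

section Unitary

/-- For an irreducible process, eigenvectors of the dual operator of norm one are unitary. -/
theorem isRandomUnitary_of_norm_eq_one (hE : E.IsIrreducible) {x : RandomMatrix μ d} {α : ℂ}
    (hα : ‖α‖ = 1) (hx : E.dualOp x = α • x) (hx1 : ∀ᵐ ω ∂μ, ‖x ω‖ = 1) : IsRandomUnitary x := by
  have hlim : ∀ᵐ ω ∂μ, ∃ q, Filter.Tendsto (fun n : ℕ => ((x ω)ᴴ * x ω) ^ n) Filter.atTop
      (nhds q) := by
    filter_upwards [hx1] with ω h
    refine exists_tendsto_pow (conjTranspose_mul_self_nonneg _) ?_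
    rw [Matrix.l2_opNorm_conjTranspose_mul_self, h, one_mul]
  -- Obtaining the projection onto `ker (1 - xᴴx)` as a limit of powers settles its measurability.
  obtain ⟨q₀, hq₀, hlim₀⟩ := exists_stronglyMeasurable_limit_of_tendsto_ae
    (fun n => ((continuous_star.comp_aestronglyMeasurable x.aestronglyMeasurable).mul
      x.aestronglyMeasurable).pow n) hlim
  let q : RandomMatrix μ d := AEEqFun.mk q₀ hq₀.aestronglyMeasurable
  have hprops : ∀ᵐ ω ∂μ, IsStarProjection (q ω) ∧ q ω ≠ 0 ∧ ((x ω)ᴴ * x ω) * q ω = q ω ∧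
      ∀ v : Mat d, ((x ω)ᴴ * x ω) * v = v → q ω * v = v := by
    filter_upwards [hlim₀, hx1, AEEqFun.coeFn_mk q₀ hq₀.aestronglyMeasurable] with ω h1 h2 h3
    have h4 : q ω = q₀ ω := h3
    rw [h4]
    refine tendsto_pow_props (conjTranspose_mul_self_nonneg _) ?_ h1
    rw [Matrix.l2_opNorm_conjTranspose_mul_self, h2, one_mul]
  have hq1 : q = 1 := by
    refine hE q (hprops.mono fun ω h => ⟨h.1, h.2.1⟩) fun a ha => ?_
    have hqa : ∀ b : RandomMatrix μ d, ∀ᵐ ω ∂μ, (q * b * q) ω = q ω * b ω * q ω := fun b => by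
      filter_upwards [AEEqFun.coeFn_mul (q * b) q, AEEqFun.coeFn_mul q b] with ω h1 h2
      rw [h1, Pi.mul_apply, h2, Pi.mul_apply]
    have hqa' := hqa a
    rw [ha] at hqa'
    have hx' := E.ae_comp_symm (E.dualOp_eq_smul_iff.mp hx)
    apply AEEqFun.ext
    filter_upwards [hqa (E.op a), E.coeFn_op a, E.ae_comp_symm hqa', hprops,
      E.ae_comp_symm hprops, E.channel, hx', hx1] with ω h1 h2 h3 h4 h5 h6 h7 h8
    rw [h1, h2]
    simp only [MeasurableEquiv.apply_symm_apply] at h7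
    -- The channel at `ω` carries the fibre over `θ⁻¹ ω` to the fibre over `ω`, so `z'` and `q'`
    -- live at `θ⁻¹ ω`.
    refine h6.corner (z := 1 - (x ω)ᴴ * x ω)
      (z' := 1 - (x (E.θ.symm ω))ᴴ * x (E.θ.symm ω)) ?_ ?_ ?_ h5.1.isSelfAdjoint.star_eq
      h4.1.isSelfAdjoint.star_eq ?_ h3.symm
    · rw [sub_nonneg, ← CStarAlgebra.norm_le_one_iff_of_nonneg _ (conjTranspose_mul_self_nonneg _),
        Matrix.l2_opNorm_conjTranspose_mul_self, h8, one_mul]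
    · obtain ⟨K, hK, hK1⟩ := h6.exists_kraus
      rw [map_sub, h6.hsAdjoint_one]
      refine sub_le_sub_left ?_ 1
      -- The eigenvalue equation turns the left side into `ᾱα xᴴx` at `θ⁻¹ ω`, and `ᾱα = 1`.
      have h9 := schwarz hK1 (x ω)
      rw [← hsAdjoint_eq_of_kraus hK, ← hsAdjoint_eq_of_kraus hK, h7, Matrix.conjTranspose_smul,
        smul_mul_smul_comm, RCLike.star_def, RCLike.conj_mul, hα] at h9
      simpa using h9
    · rw [sub_mul, one_mul, h5.2.2.1, sub_self]
    · intro v hv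
      rw [sub_mul, one_mul, sub_eq_zero] at hv
      exact h4.2.2.2 v hv.symm
  filter_upwards [hprops, AEEqFun.coeFn_one (μ := μ) (β := Mat d)] with ω h1 h2
  have h3 := h1.2.2.1
  rw [hq1, h2, Pi.one_apply, mul_one] at h3
  exact Matrix.mem_unitaryGroup_iff'.mpr h3

theorem exists_unitary_of_dualOp [IsProbabilityMeasure μ] (hE : E.IsIrreducible)
    {x : RandomMatrix μ d} {α : ℂ} (hα : ‖α‖ = 1) (hx0 : x ≠ 0) (hx : E.dualOp x = α • x) :
    ∃ (u : RandomMatrix μ d) (c : ℂ), IsRandomUnitary u ∧ c ≠ 0 ∧ x = c • u ∧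
      E.dualOp u = α • u := by
  obtain ⟨c, hc⟩ := E.exists_norm_eq_of_dualOp hα hx
  have hc0 : c ≠ 0 := by
    rintro rfl
    refine hx0 (AEEqFun.ext ?_)
    filter_upwards [hc, AEEqFun.coeFn_zero (μ := μ) (β := Mat d)] with ω h1 h2
    rw [h2, Pi.zero_apply, norm_eq_zero.mp h1]
  have hc0' : (c : ℂ) ≠ 0 := by exact_mod_cast hc0
  have hu : E.dualOp ((c : ℂ)⁻¹ • x) = α • ((c : ℂ)⁻¹ • x) := by
    rw [map_smul, hx, smul_comm]
  refine ⟨(c : ℂ)⁻¹ • x, c, E.isRandomUnitary_of_norm_eq_one hE hα hu ?_, hc0', ?_, hu⟩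
  · filter_upwards [hc, AEEqFun.coeFn_smul (c : ℂ)⁻¹ x] with ω h1 h2
    have h3 : 0 ≤ c := h1 ▸ norm_nonneg _
    rw [h2, Pi.smul_apply, norm_smul, h1, norm_inv, Complex.norm_real, Real.norm_of_nonneg h3,
      inv_mul_cancel₀ hc0]
  · rw [smul_smul, mul_inv_cancel₀ hc0', one_smul]

theorem _root_.QuantumProcess.IsRandomUnitary.ne_zero [NeZero μ] [NeZero d]
    {u : RandomMatrix μ d} (hu : IsRandomUnitary u) : u ≠ 0 := by
  rintro rfl
  obtain ⟨ω, h1, h2⟩ := (hu.and (AEEqFun.coeFn_zero (μ := μ) (β := Mat d))).exists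
  rw [h2, Pi.zero_apply, Matrix.mem_unitaryGroup_iff, zero_mul] at h1
  exact zero_ne_one h1

theorem coeFn_star_mul (u v : RandomMatrix μ d) : ∀ᵐ ω ∂μ, (star u * v) ω = (u ω)ᴴ * v ω := by
  filter_upwards [AEEqFun.coeFn_mul (star u) v, AEEqFun.coeFn_star u] with ω h1 h2
  rw [h1, Pi.mul_apply, h2, Pi.star_apply, Matrix.star_eq_conjTranspose]

theorem _root_.QuantumProcess.IsRandomUnitary.star_mul {u v : RandomMatrix μ d}
    (hu : IsRandomUnitary u) (hv : IsRandomUnitary v) : IsRandomUnitary (star u * v) := by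
  filter_upwards [hu, hv, coeFn_star_mul u v] with ω h1 h2 h3
  rw [h3]
  exact mul_mem (Unitary.star_mem h1) h2

/-- The dual channel sends the unitary `u (θ ω)` to the unitary `α • u ω`, so `u` is in its
multiplicative domain. The other factor `v` need not be unitary. -/
theorem dualOp_star_mul {u v : RandomMatrix μ d} (hu : IsRandomUnitary u) {α β : ℂ}
    (hα : ‖α‖ = 1) (h1 : E.dualOp u = α • u) (h2 : E.dualOp v = β • v) :
    E.dualOp (star u * v) = (star α * β) • (star u * v) := by
  rw [E.dualOp_eq_smul_iff] at h1 h2 ⊢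
  filter_upwards [h1, h2, hu, E.ae_comp hu, coeFn_star_mul u v,
    E.ae_comp (coeFn_star_mul u v), E.ae_comp E.channel] with ω h3 h4 h5 h6 h7 h8 h9
  rw [h7, h8, h9.hsAdjoint_mul (Matrix.mem_unitaryGroup_iff'.mp h6), h3, h4,
    Matrix.conjTranspose_smul, smul_mul_smul_comm]
  rw [h3, Matrix.conjTranspose_smul, smul_mul_smul_comm, RCLike.star_def, RCLike.conj_mul, hα,
    ← Matrix.star_eq_conjTranspose, Matrix.mem_unitaryGroup_iff'.mp h5]
  simp

end Unitary

/-! ### Power bounds on the `L^p` spaces -/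

section Bounds

theorem norm_restrictLp_dualOp_le (p : ℝ≥0∞) [Fact (1 ≤ p)] (f : Lp (Mat d) p μ) :
    ‖restrictLp E.dualOp p (E.isBoundedOnLp_dualOp p) f‖ ≤ ‖f‖ := by
  rw [← Lp.norm_compMeasurePreserving f E.ergodic.toMeasurePreserving]
  refine Lp.norm_le_norm_of_ae_le ?_
  filter_upwards [E.coeFn_dualOp (f : RandomMatrix μ d), E.ae_comp E.channel,
    Lp.coeFn_compMeasurePreserving f E.ergodic.toMeasurePreserving] with ω h1 h2 h3
  rw [h3, coe_restrictLp, h1]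
  exact h2.norm_hsAdjoint_le _

theorem norm_restrictLp_dualOp_pow_le (p : ℝ≥0∞) [Fact (1 ≤ p)] (n : ℕ) :
    ‖(restrictLp E.dualOp p (E.isBoundedOnLp_dualOp p)) ^ n‖ ≤ 1 := by
  have := norm_pow_le_of_monotone (M := fun f => ‖f‖) zero_le_one zero_le_one
    (E.norm_restrictLp_dualOp_le p) (by simp) (by simp) n
  simpa using this

/-- The integrated trace norm does not increase under `𝓛`; the factors `d ^ 2` and `d` compare it
with the `L¹` norm. -/
theorem norm_opL1_pow_le (n : ℕ) : ‖E.opL1 ^ n‖ ≤ d ^ 2 * d := by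
  have hint : ∀ f : Lp (Mat d) 1 μ, Integrable (fun ω => dualNorm (f ω)) μ := fun f => by
    refine ((L1.integrable_coeFn f).norm.const_mul (d : ℝ)).mono'
      (continuous_dualNorm.comp_aestronglyMeasurable (Lp.aestronglyMeasurable f))
      (Filter.Eventually.of_forall fun ω => ?_)
    rw [Real.norm_of_nonneg (dualNorm_nonneg _)]
    exact QuantumProcess.dualNorm_le _
  refine norm_pow_le_of_monotone (M := fun f => ∫ ω, dualNorm (f ω) ∂μ) (by positivity)
    (by positivity) (fun f => ?_) (fun f => ?_) (fun f => ?_) n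
  · have h1 : ∫ ω, dualNorm (f (E.θ.symm ω)) ∂μ = ∫ ω, dualNorm (f ω) ∂μ :=
      E.measurePreserving_symm.integral_comp' (fun ω => dualNorm (f ω))
    rw [← h1]
    refine integral_mono_ae (hint _)
      (E.measurePreserving_symm.integrable_comp_of_integrable (hint f)) ?_
    filter_upwards [E.coeFn_op (f : RandomMatrix μ d), E.channel] with ω h2 h3
    change dualNorm ((E.op f) ω) ≤ _
    rw [h2]
    exact h3.dualNorm_le _
  · rw [L1.norm_eq_integral_norm, ← integral_const_mul]
    exact integral_mono (L1.integrable_coeFn f).norm ((hint f).const_mul _)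
      fun ω => norm_le_dualNorm _
  · rw [L1.norm_eq_integral_norm, ← integral_const_mul]
    exact integral_mono (hint f) ((L1.integrable_coeFn f).norm.const_mul _)
      fun ω => QuantumProcess.dualNorm_le _

end Bounds

end ErgodicQuantumProcess

/-! ### Hilbert space duality between the two operators -/

section HilbertSchmidt

variable {d : ℕ}

/-- Matrices as vectors for the Hilbert–Schmidt inner product. -/
def hsEquiv (d : ℕ) : Mat d ≃L[ℂ] EuclideanSpace ℂ (Fin d × Fin d) :=
  ((Matrix.ofLinearEquiv ℂ).symm.trans ((LinearEquiv.curry ℂ ℂ (Fin d) (Fin d)).symm.trans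
    (WithLp.linearEquiv 2 ℂ (Fin d × Fin d → ℂ)).symm)).toContinuousLinearEquiv

theorem inner_hsEquiv (a b : Mat d) : inner ℂ (hsEquiv d a) (hsEquiv d b) = (aᴴ * b).trace := by
  have h : ∀ (a : Mat d) (i j : Fin d), (hsEquiv d a) (i, j) = a i j := fun _ _ _ => rfl
  rw [PiLp.inner_apply, Fintype.sum_prod_type]
  simp only [h, Matrix.trace, Matrix.diag, Matrix.mul_apply, Matrix.conjTranspose_apply,
    RCLike.inner_apply', RCLike.star_def]
  exact Finset.sum_comm

end HilbertSchmidt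

namespace ErgodicQuantumProcess

variable {Ω : Type*} [MeasurableSpace Ω] {μ : Measure Ω} {d : ℕ} (E : ErgodicQuantumProcess μ d)

section Hilbert

/-- Square integrable random matrices as a Hilbert space. -/
abbrev HSSpace (μ : Measure Ω) (d : ℕ) : Type _ := Lp (EuclideanSpace ℂ (Fin d × Fin d)) 2 μ

/-- The identification of square integrable random matrices with a Hilbert space. -/
def toHS : Lp (Mat d) 2 μ →L[ℂ] HSSpace μ d :=
  (hsEquiv d : Mat d →L[ℂ] EuclideanSpace ℂ (Fin d × Fin d)).compLpL 2 μ

/-- The inverse of `toHS`. -/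
def ofHS : HSSpace μ d →L[ℂ] Lp (Mat d) 2 μ :=
  ((hsEquiv d).symm : EuclideanSpace ℂ (Fin d × Fin d) →L[ℂ] Mat d).compLpL 2 μ

theorem coeFn_toHS (f : Lp (Mat d) 2 μ) : ∀ᵐ ω ∂μ, toHS f ω = hsEquiv d (f ω) :=
  ContinuousLinearMap.coeFn_compLpL _ f

theorem coeFn_ofHS (f : HSSpace μ d) : ∀ᵐ ω ∂μ, ofHS f ω = (hsEquiv d).symm (f ω) :=
  ContinuousLinearMap.coeFn_compLpL _ f

theorem ofHS_toHS (f : Lp (Mat d) 2 μ) : ofHS (toHS f) = f := by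
  apply Lp.ext
  filter_upwards [coeFn_ofHS (toHS f), coeFn_toHS f] with ω h1 h2
  rw [h1, h2, ContinuousLinearEquiv.symm_apply_apply]

theorem toHS_ofHS (f : HSSpace μ d) : toHS (ofHS f) = f := by
  apply Lp.ext
  filter_upwards [coeFn_toHS (ofHS f), coeFn_ofHS f] with ω h1 h2
  rw [h1, h2, ContinuousLinearEquiv.apply_symm_apply]

theorem inner_toHS (f g : Lp (Mat d) 2 μ) :
    inner ℂ (toHS f) (toHS g) = ∫ ω, ((f ω)ᴴ * g ω).trace ∂μ := by
  rw [L2.inner_def]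
  refine integral_congr_ae ?_
  filter_upwards [coeFn_toHS f, coeFn_toHS g] with ω h1 h2
  rw [h1, h2, inner_hsEquiv]

/-- The operator of the process on the Hilbert space. -/
def hsOp : HSSpace μ d →L[ℂ] HSSpace μ d :=
  toHS ∘L restrictLp E.op 2 (E.isBoundedOnLp_op 2) ∘L ofHS

/-- The dual operator of the process on the Hilbert space. -/
def hsDualOp : HSSpace μ d →L[ℂ] HSSpace μ d :=
  toHS ∘L restrictLp E.dualOp 2 (E.isBoundedOnLp_dualOp 2) ∘L ofHS

/-- Fibrewise this is the defining property of `hsAdjoint`; invariance of `μ` under `θ⁻¹` matches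
the fibres. -/
theorem hsOp_eq_adjoint : E.hsOp = ContinuousLinearMap.adjoint E.hsDualOp := by
  rw [ContinuousLinearMap.eq_adjoint_iff]
  intro f g
  set a := ofHS f with ha
  set b := ofHS g with hb
  have hf : f = toHS a := (toHS_ofHS f).symm
  have hg : g = toHS b := (toHS_ofHS g).symm
  have h1 : E.hsOp f = toHS (restrictLp E.op 2 (E.isBoundedOnLp_op 2) a) := rfl
  have h2 : E.hsDualOp g = toHS (restrictLp E.dualOp 2 (E.isBoundedOnLp_dualOp 2) b) := rfl
  rw [h1, h2, hf, hg, inner_toHS, inner_toHS]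
  have h3 : ∫ ω, ((a ω)ᴴ * hsAdjoint (E.φ (E.θ ω)) (b (E.θ ω))).trace ∂μ =
      ∫ ω, ((a (E.θ.symm ω))ᴴ * hsAdjoint (E.φ ω) (b ω)).trace ∂μ := by
    rw [← E.measurePreserving_symm.integral_comp']
    simp
  refine Eq.trans ?_ (Eq.trans h3.symm ?_)
  · refine integral_congr_ae ?_
    filter_upwards [E.coeFn_op (a : RandomMatrix μ d)] with ω h
    rw [coe_restrictLp, h, hsAdjoint_spec]
  · refine integral_congr_ae ?_
    filter_upwards [E.coeFn_dualOp (b : RandomMatrix μ d)] with ω h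
    rw [coe_restrictLp, h]

/-- `𝓛†` contracts `L²` for the operator norm on fibres, which is equivalent to the Hilbert–Schmidt
norm. -/
theorem norm_hsDualOp_pow_le : ∃ C : ℝ, ∀ n : ℕ, ‖E.hsDualOp ^ n‖ ≤ C := by
  let J : Lp (Mat d) 2 μ →L[ℂ] HSSpace μ d := toHS
  let J' : HSSpace μ d →L[ℂ] Lp (Mat d) 2 μ := ofHS
  refine ⟨‖J‖ * ‖J'‖, fun n => ?_⟩
  refine norm_pow_le_of_monotone (M := fun f => ‖J' f‖) (norm_nonneg J) (norm_nonneg J')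
    (fun f => ?_) (fun f => ?_) (fun f => J'.le_opNorm f) n
  · change ‖ofHS (toHS _)‖ ≤ _
    rw [ofHS_toHS]
    exact E.norm_restrictLp_dualOp_le 2 (J' f)
  · conv_lhs => rw [← toHS_ofHS f]
    exact J.le_opNorm _

theorem exists_ne_zero_of_hs {A : RandomMatrix μ d →ₗ[ℂ] RandomMatrix μ d}
    (hA : IsBoundedOnLp A 2) {α : ℂ} {z : HSSpace μ d} (hz : z ≠ 0)
    (h : (toHS ∘L restrictLp A 2 hA ∘L ofHS) z = α • z) :
    ∃ x : RandomMatrix μ d, x ≠ 0 ∧ A x = α • x := by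
  refine ⟨(ofHS z : Lp (Mat d) 2 μ), ?_, ?_⟩
  · intro h0
    have h1 : ofHS z = 0 := Subtype.ext h0
    exact hz (by rw [← toHS_ofHS z, h1, map_zero])
  · have h1 := congrArg ofHS h
    rw [map_smul] at h1
    have h2 : restrictLp A 2 hA (ofHS z) = α • ofHS z := by
      rw [← h1]; exact (ofHS_toHS _).symm
    exact congrArg Subtype.val h2

theorem hs_eigenvector {A : RandomMatrix μ d →ₗ[ℂ] RandomMatrix μ d}
    (hA : IsBoundedOnLp A 2) {α : ℂ} {x : RandomMatrix μ d} (hx : x ≠ 0) (h : A x = α • x)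
    (hx2 : x ∈ Lp (Mat d) 2 μ) :
    ∃ z : HSSpace μ d, z ≠ 0 ∧ (toHS ∘L restrictLp A 2 hA ∘L ofHS) z = α • z := by
  refine ⟨toHS ⟨x, hx2⟩, fun h0 => hx ?_, ?_⟩
  · have h1 : (⟨x, hx2⟩ : Lp (Mat d) 2 μ) = 0 := by rw [← ofHS_toHS ⟨x, hx2⟩, h0, map_zero]
    exact congrArg Subtype.val h1
  · have h2 : restrictLp A 2 hA ⟨x, hx2⟩ = α • ⟨x, hx2⟩ := Subtype.ext h
    change toHS (restrictLp A 2 hA (ofHS (toHS ⟨x, hx2⟩))) = _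
    rw [ofHS_toHS, h2, map_smul]

/-- The eigenvector has constant norm, hence is in `L²`, where the mean ergodic argument applies.
Irreducibility plays no role. -/
theorem exists_op_eigenvector [IsProbabilityMeasure μ] {α : ℂ} (hα : ‖α‖ = 1)
    {x : RandomMatrix μ d} (hx : x ≠ 0) (h : E.dualOp x = α • x) :
    ∃ y : RandomMatrix μ d, y ≠ 0 ∧ E.op y = star α • y := by
  obtain ⟨c, hc⟩ := E.exists_norm_eq_of_dualOp hα h
  obtain ⟨w, hw, hPw⟩ := hs_eigenvector (E.isBoundedOnLp_dualOp 2) hx h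
    (mem_Lp_of_norm_le (hc.mono fun _ h => h.le) 2)
  obtain ⟨C, hC⟩ := E.norm_hsDualOp_pow_le
  obtain ⟨z, hz, hPz⟩ := exists_adjoint_eigenvector hC hα hw hPw
  rw [← E.hsOp_eq_adjoint] at hPz
  exact exists_ne_zero_of_hs (E.isBoundedOnLp_op 2) hz hPz

theorem exists_dualOp_eigenvector [IsProbabilityMeasure μ] {α : ℂ} (hα : ‖α‖ = 1)
    {x : RandomMatrix μ d} (hx : x ≠ 0) (h : E.op x = α • x) :
    ∃ y : RandomMatrix μ d, y ≠ 0 ∧ E.dualOp y = star α • y := by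
  obtain ⟨c, hc⟩ := E.exists_norm_le_of_op hα h
  obtain ⟨w, hw, hPw⟩ := hs_eigenvector (E.isBoundedOnLp_op 2) hx h (mem_Lp_of_norm_le hc 2)
  obtain ⟨C, hC⟩ := E.norm_hsDualOp_pow_le
  have hC' : ∀ n : ℕ, ‖E.hsOp ^ n‖ ≤ C := fun n => by
    rw [hsOp_eq_adjoint, ← ContinuousLinearMap.star_eq_adjoint, ← star_pow,
      ContinuousLinearMap.star_eq_adjoint, LinearIsometryEquiv.norm_map]
    exact hC n
  obtain ⟨z, hz, hPz⟩ := exists_adjoint_eigenvector hC' hα hw hPw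
  rw [E.hsOp_eq_adjoint, ContinuousLinearMap.adjoint_adjoint] at hPz
  exact exists_ne_zero_of_hs (E.isBoundedOnLp_dualOp 2) hz hPz

end Hilbert

/-! ### Peripheral eigenvalues and their group structure -/

section Peripheral

/-- The peripheral eigenvalues of the restriction to `L^p` of an operator on random matrices. -/
theorem peripheralEigenvalues_restrictLp {A : RandomMatrix μ d →ₗ[ℂ] RandomMatrix μ d}
    {p : ℝ≥0∞} [Fact (1 ≤ p)] (hA : IsBoundedOnLp A p) {C : ℝ}
    (hC : ∀ n : ℕ, ‖(restrictLp A p hA) ^ n‖ ≤ C)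
    (hmem : ∀ (α : ℂ) (x : RandomMatrix μ d), ‖α‖ = 1 → A x = α • x → x ∈ Lp (Mat d) p μ)
    {x₀ : RandomMatrix μ d} (hx₀ : x₀ ≠ 0) (h₀ : A x₀ = x₀) :
    peripheralEigenvalues (restrictLp A p hA) =
      {α : ℂ | ‖α‖ = 1 ∧ ∃ x : RandomMatrix μ d, x ≠ 0 ∧ A x = α • x} := by
  have h1 : x₀ ∈ Lp (Mat d) p μ := hmem 1 x₀ (by simp) (by rw [one_smul, h₀])
  rw [peripheralEigenvalues_eq hC (x₀ := ⟨x₀, h1⟩) (fun h => hx₀ (congrArg Subtype.val h))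
    (Subtype.ext h₀)]
  ext α
  refine and_congr_right fun hα => ⟨?_, ?_⟩
  · rintro ⟨x, hx, hAx⟩
    exact ⟨x, fun h => hx (Subtype.ext h), congrArg Subtype.val hAx⟩
  · rintro ⟨x, hx, hAx⟩
    exact ⟨⟨x, hmem α x hα hAx⟩, fun h => hx (congrArg Subtype.val h), Subtype.ext hAx⟩

variable [IsProbabilityMeasure μ]

theorem one_ne_zero [NeZero d] : (1 : RandomMatrix μ d) ≠ 0 := by
  apply IsRandomUnitary.ne_zero
  filter_upwards [AEEqFun.coeFn_one (μ := μ) (β := Mat d)] with ω h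
  rw [h]
  exact one_mem _

theorem peripheralEigenvalues_dualOpLinfty [NeZero d] :
    peripheralEigenvalues E.dualOpLinfty =
      {α : ℂ | ‖α‖ = 1 ∧ ∃ x : RandomMatrix μ d, x ≠ 0 ∧ E.dualOp x = α • x} := by
  refine peripheralEigenvalues_restrictLp _ (E.norm_restrictLp_dualOp_pow_le ∞)
    (fun α x hα hx => ?_) one_ne_zero E.dualOp_one
  obtain ⟨c, hc⟩ := E.exists_norm_eq_of_dualOp hα hx
  exact mem_Lp_of_norm_le (hc.mono fun _ h => h.le) ∞

theorem peripheralEigenvalues_opL1 [NeZero d] :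
    peripheralEigenvalues E.opL1 =
      {α : ℂ | ‖α‖ = 1 ∧ ∃ x : RandomMatrix μ d, x ≠ 0 ∧ E.op x = α • x} := by
  -- Duality applied to the fixed point `1` of `𝓛†` yields a nonzero fixed point of `𝓛`.
  obtain ⟨ρ, hρ, hρ1⟩ := E.exists_op_eigenvector (α := 1) (by simp) one_ne_zero
    (by rw [one_smul, E.dualOp_one])
  rw [star_one, one_smul] at hρ1
  refine peripheralEigenvalues_restrictLp _ E.norm_opL1_pow_le (fun α x hα hx => ?_) hρ hρ1
  obtain ⟨c, hc⟩ := E.exists_norm_le_of_op hα hx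
  exact mem_Lp_of_norm_le hc 1

/-- The unimodular eigenvalues of the dual operator of an irreducible process, as a group. -/
def dualEigenvalueGroup [NeZero d] (hE : E.IsIrreducible) : Subgroup Circle :=
  Subgroup.ofDiv {z : Circle | ∃ x : RandomMatrix μ d, x ≠ 0 ∧ E.dualOp x = (z : ℂ) • x}
    ⟨1, 1, one_ne_zero, by rw [Circle.coe_one, one_smul, E.dualOp_one]⟩ (by
      rintro z ⟨x, hx, hzx⟩ w ⟨y, hy, hwy⟩
      obtain ⟨u, _, hu, -, -, hzu⟩ := E.exists_unitary_of_dualOp hE z.norm_coe hx hzx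
      obtain ⟨v, _, hv, -, -, hwv⟩ := E.exists_unitary_of_dualOp hE w.norm_coe hy hwy
      -- The eigenvalue is `w̄ z`, which is `z / w` on the circle.
      refine ⟨star v * u, (hv.star_mul hu).ne_zero, ?_⟩
      rw [E.dualOp_star_mul hv w.norm_coe hwv hzu]
      congr 1
      rw [Circle.coe_mul, Circle.coe_inv_eq_conj, mul_comm]
      rfl)

theorem mem_dualEigenvalueGroup [NeZero d] (hE : E.IsIrreducible) {z : Circle} :
    z ∈ E.dualEigenvalueGroup hE ↔
      ∃ x : RandomMatrix μ d, x ≠ 0 ∧ E.dualOp x = (z : ℂ) • x := Iff.rfl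

theorem coe_image_dualEigenvalueGroup [NeZero d] (hE : E.IsIrreducible) :
    (fun z : Circle => (z : ℂ)) '' (E.dualEigenvalueGroup hE : Set Circle) =
      {α : ℂ | ‖α‖ = 1 ∧ ∃ x : RandomMatrix μ d, x ≠ 0 ∧ E.dualOp x = α • x} := by
  ext α
  constructor
  · rintro ⟨z, hz, rfl⟩
    exact ⟨z.norm_coe, hz⟩
  · rintro ⟨hα, hx⟩
    exact ⟨⟨α, mem_sphere_zero_iff_norm.mpr hα⟩, hx, rfl⟩

theorem star_mem_dual_eigenvalues [NeZero d] (hE : E.IsIrreducible) {α : ℂ} (hα : ‖α‖ = 1)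
    (h : ∃ x : RandomMatrix μ d, x ≠ 0 ∧ E.dualOp x = α • x) :
    ∃ x : RandomMatrix μ d, x ≠ 0 ∧ E.dualOp x = star α • x := by
  let z : Circle := ⟨α, mem_sphere_zero_iff_norm.mpr hα⟩
  have h1 : z⁻¹ ∈ E.dualEigenvalueGroup hE := inv_mem (show z ∈ E.dualEigenvalueGroup hE from h)
  rw [mem_dualEigenvalueGroup, Circle.coe_inv_eq_conj] at h1
  exact h1

/-- The operator and the dual operator have the same unimodular eigenvalues. -/
theorem op_eigenvalues_eq_dualOp_eigenvalues [NeZero d] (hE : E.IsIrreducible) :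
    {α : ℂ | ‖α‖ = 1 ∧ ∃ x : RandomMatrix μ d, x ≠ 0 ∧ E.op x = α • x} =
      {α : ℂ | ‖α‖ = 1 ∧ ∃ x : RandomMatrix μ d, x ≠ 0 ∧ E.dualOp x = α • x} := by
  ext α
  refine and_congr_right fun hα => ⟨?_, ?_⟩
  · rintro ⟨x, hx, h⟩
    -- Duality conjugates the eigenvalue, and inversion in the group conjugates it back.
    rw [← star_star α]
    exact E.star_mem_dual_eigenvalues hE (by rwa [norm_star])
      (E.exists_dualOp_eigenvector hα hx h)
  · intro h
    obtain ⟨x, hx, h1⟩ := E.star_mem_dual_eigenvalues hE hα h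
    rw [← star_star α]
    exact E.exists_op_eigenvector (by rwa [norm_star]) hx h1

end Peripheral

end ErgodicQuantumProcess

end QuantumProcess

end

/-- For an irreducible ergodic quantum process, the peripheral eigenvalues of `𝓛` form a group
under multiplication, they coincide with those of `𝓛†`, and every eigenvector of `𝓛†` with
eigenvalue of modulus one is a scalar multiple of a random unitary. -/
theorem mainTheorem6 {Ω : Type*} [MeasurableSpace Ω] (μ : MeasureTheory.Measure Ω)
    [MeasureTheory.IsProbabilityMeasure μ] (d : ℕ) (hd : 1 ≤ d)
    (E : QuantumProcess.ErgodicQuantumProcess μ d) (hE : E.IsIrreducible) :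
    (∃ G : Subgroup Circle,
      QuantumProcess.peripheralEigenvalues E.opL1 = (fun z : Circle => (z : ℂ)) '' (G : Set Circle)) ∧
    QuantumProcess.peripheralEigenvalues E.opL1 =
      QuantumProcess.peripheralEigenvalues E.dualOpLinfty ∧
    QuantumProcess.peripheralEigenvalues E.opL1 =
      {α : ℂ | ‖α‖ = 1 ∧ ∃ x : QuantumProcess.RandomMatrix μ d, x ≠ 0 ∧ E.op x = α • x} ∧
    QuantumProcess.peripheralEigenvalues E.dualOpLinfty =
      {α : ℂ | ‖α‖ = 1 ∧ ∃ x : QuantumProcess.RandomMatrix μ d, x ≠ 0 ∧ E.dualOp x = α • x} ∧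
    ∀ (α : ℂ) (x : QuantumProcess.RandomMatrix μ d), ‖α‖ = 1 → x ≠ 0 → E.dualOp x = α • x →
      ∃ (u : QuantumProcess.RandomMatrix μ d) (c : ℂ),
        QuantumProcess.IsRandomUnitary u ∧ c ≠ 0 ∧ x = c • u := by
  have : NeZero d := ⟨by omega⟩
  refine ⟨⟨E.dualEigenvalueGroup hE, ?_⟩, ?_, E.peripheralEigenvalues_opL1,
    E.peripheralEigenvalues_dualOpLinfty, fun α x hα hx0 hx => ?_⟩
  · rw [E.peripheralEigenvalues_opL1, E.op_eigenvalues_eq_dualOp_eigenvalues hE,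
      E.coe_image_dualEigenvalueGroup hE]
  · rw [E.peripheralEigenvalues_opL1, E.op_eigenvalues_eq_dualOp_eigenvalues hE,
      E.peripheralEigenvalues_dualOpLinfty]
  · obtain ⟨u, c, hu, hc, hxu, -⟩ := E.exists_unitary_of_dualOp hE hα hx0 hx
    exact ⟨u, c, hu, hc, hxu⟩
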